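/- Let $M$ be a smooth $m$-dimensional manifold and $V\subset M$ a smooth embedded $m'$-dimensional submanifold, with normal bundle $\mathcal N_V^M=TM|_V/TV$. Let $\mathrm{DNC}(M,V)=M\times\mathbb R^*\sqcup \mathcal N_V^M\times\{0\}$ be the deformation to the normal cone, with its canonical smooth structure: $M\times\mathbb R^*$ is open, and for every chart $\varphi$ of $M$ with values in $\mathbb R^{m'}\times\mathbb R^{m-m'}$ in which $V$ is the slice $\mathbb R^{m'}\times\{0\}$, the map $(y,\xi,t)\mapsto(\varphi^{-1}(y,t\xi),t)$ for $t\neq0$, $(y,\xi,0)\mapsto(\varphi^{-1}(y,0),[d\varphi^{-1}_{(y,0)}(0,\xi)],0)$ is a local parametrization. The zoom action of $s>0$ is $\alpha_s(x,t)=(x,s^{-1}t)$ for $t\ne0$ and $\alpha_s(x,X,0)=(x,sX,0)$. For $a\in\mathbb C$, a function $f$ is $a$-homogeneous if $f\circ\alpha_s=s^af$ for all $s>0$. For $b\in\mathbb C$ and $t\in\mathbb R^*$ put $t_+^b=t^b$ if $t>0$ and $t_+^b=0$ if $t<0$, and $t_-^b=(-t)_+^b$. A smooth function on $M$ vanishes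 to order $k$ on $V$ if it and all its derivatives of order at most $k$ vanish at every point of $V$; it is flat on $V$ if this holds for every $k$. $X^{(k)}g$ denotes the $k$-th directional derivative of $g$ along $X$; for $k\ge 1$ and $g$ vanishing to order $k-1$ on $V$, its value at $x\in V$ is well defined for a normal vector $X\in T_xM/T_xV$. **Theorem (Characterization of smooth homogeneous functions on $\mathrm{DNC}(M,V)$).** Let $a\in\mathbb C$ and $f:\mathrm{DNC}(M,V)\to\mathbb C$. 1. If $a\in\{0,-1,-2,\dots\}$, then $f$ is smooth and $a$-homogeneous if and only if there are smooth functions $f_{M-},f_{M+}:M\to\mathbb C$ such that $f_{M+}-f_{M-}$ is flat on $V$ and $$f(x,t)=(-1)^af_{M-}(x)\,t_-^{-a}+f_{M+}(x)\,t_+^{-a}\quad(t\neq0),\qquad f(x,X,0)=\begin{cases}0&\text{if }a<0,\\ f_{M+}(x)&\text{if }a=0.\end{cases}$$ 2. If $a\in\{1,2,\dots\}$, then $f$ is smooth and $a$-homogeneous if and only if there are smooth functions $f_{M-},f_{M+}:M\to\mathbb C$, both vanishing to order $a-1$ on $V$, such that $f_{M+}-f_{M-}$ is flat on $V$ and $$f(x,t)=(-1)^af_{M-}(x)\,t_-^{-a}+f_{M+}(x)\,t_+^{-a}\quad(t\neq0),\qquad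 f(x,X,0)=\frac1{a!}\,(X^{(a)}f_{M+})(x).$$ 3. If $a\in\mathbb C\setminus\mathbb Z$, then $f$ is smooth and $a$-homogeneous if and only if there are smooth functions $f_{M-},f_{M+}:M\to\mathbb C$, both flat on $V$, such that $$f(x,t)=f_{M-}(x)\,t_-^{-a}+f_{M+}(x)\,t_+^{-a}\quad(t\neq0),\qquad f(x,X,0)=0.$$ -/

import Mathlib

open scoped Manifold ContDiff

/-- The fibre at `x` of the normal bundle of the submanifold `ι : V → M`, that is
`T_{ι x} M / T_x V`. -/
abbrev NormalFiber (m' m : ℕ) {V M : Type*}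
    [TopologicalSpace V] [ChartedSpace (EuclideanSpace ℝ (Fin m')) V]
    [TopologicalSpace M] [ChartedSpace (EuclideanSpace ℝ (Fin m)) M]
    (ι : V → M) (x : V) : Type :=
  TangentSpace (𝓡 m) (ι x) ⧸ (mfderiv (𝓡 m') (𝓡 m) ι x).range

/-- The deformation to the normal cone of the submanifold `ι : V → M`: the disjoint union of
`M × ℝ^*` and of the normal bundle (placed over the parameter `t = 0`). -/
inductive DNC (m' m : ℕ) {V M : Type*}
    [TopologicalSpace V] [ChartedSpace (EuclideanSpace ℝ (Fin m')) V]
    [TopologicalSpace M] [ChartedSpace (EuclideanSpace ℝ (Fin m)) M]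
    (ι : V → M)
  /-- the point `(x, t)` with `t ≠ 0` -/
  | generic (x : M) (t : ℝˣ) : DNC m' m ι
  /-- the point `(x, X, 0)` -/
  | normal (x : V) (X : NormalFiber m' m ι x) : DNC m' m ι

/-- A pair of charts `χ` of `V` and `φ` of `M` in which `V` is the slice `ℝ^{m'} × {0}` of
`ℝ^{m'} × ℝ^{m - m'}`; `L` splits the model space of `M` as this product. -/
structure AdaptedChart (m' m : ℕ) {V M : Type*}
    [TopologicalSpace V] [ChartedSpace (EuclideanSpace ℝ (Fin m')) V]
    [TopologicalSpace M] [ChartedSpace (EuclideanSpace ℝ (Fin m)) M]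
    (ι : V → M) where
  χ : OpenPartialHomeomorph V (EuclideanSpace ℝ (Fin m'))
  φ : OpenPartialHomeomorph M (EuclideanSpace ℝ (Fin m))
  L : EuclideanSpace ℝ (Fin m) ≃L[ℝ]
    EuclideanSpace ℝ (Fin m') × EuclideanSpace ℝ (Fin (m - m'))
  χ_mem : χ ∈ IsManifold.maximalAtlas (𝓡 m') ∞ V
  φ_mem : φ ∈ IsManifold.maximalAtlas (𝓡 m) ∞ M
  source_eq : χ.source = ι ⁻¹' φ.source
  apply_eq : ∀ x ∈ χ.source, L (φ (ι x)) = (χ x, 0)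
  mem_target : ∀ y, L.symm (y, 0) ∈ φ.target → y ∈ χ.target

namespace AdaptedChart

variable {m' m : ℕ} {V M : Type*}
  [TopologicalSpace V] [ChartedSpace (EuclideanSpace ℝ (Fin m')) V]
  [TopologicalSpace M] [ChartedSpace (EuclideanSpace ℝ (Fin m)) M]
  {ι : V → M}

/-- The open set of the `(y, ξ, t)` such that `(y, t ξ)` is in the target of the chart of `M`. -/
def domain (c : AdaptedChart m' m ι) :
    Set (EuclideanSpace ℝ (Fin m') × EuclideanSpace ℝ (Fin (m - m')) × ℝ) :=
  {p | c.L.symm (p.1, p.2.2 • p.2.1) ∈ c.φ.target}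

open Classical in
/-- The local parametrization (inverse of a chart) of the deformation to the normal cone:
`(y, ξ, t)` is sent to `(φ⁻¹ (y, t ξ), t)` if `t ≠ 0`, and to `(x, X, 0)` if `t = 0`, where `x` is
the point of `V` with coordinates `(y, 0)` and `X` is the class of the tangent vector at `x` that
has coordinates `(0, ξ)`. -/
noncomputable def param (c : AdaptedChart m' m ι)
    (p : EuclideanSpace ℝ (Fin m') × EuclideanSpace ℝ (Fin (m - m')) × ℝ) : DNC m' m ι :=
  if h : p.2.2 = 0 then
    DNC.normal (c.χ.symm p.1)
      (Submodule.Quotient.mk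
        ((mfderiv (𝓡 m) 𝓘(ℝ, EuclideanSpace ℝ (Fin m)) c.φ (ι (c.χ.symm p.1))).inverse
          (c.L.symm (0, p.2.1))))
  else
    DNC.generic (c.φ.symm (c.L.symm (p.1, p.2.2 • p.2.1))) (Units.mk0 p.2.2 h)

end AdaptedChart

namespace DNC

variable {m' m : ℕ} {V M : Type*}
  [TopologicalSpace V] [ChartedSpace (EuclideanSpace ℝ (Fin m')) V]
  [TopologicalSpace M] [ChartedSpace (EuclideanSpace ℝ (Fin m)) M]
  {ι : V → M}

/-- Smooth functions for the canonical manifold structure, whose atlas consists of the charts of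
the open part `M × ℝ^*` and of the charts induced by all adapted charts of `(M, V)`. -/
def IsSmooth (f : DNC m' m ι → ℂ) : Prop :=
  ContMDiff ((𝓡 m).prod 𝓘(ℝ, ℝ)) 𝓘(ℝ, ℂ) ∞ (fun p : M × ℝˣ => f (generic p.1 p.2)) ∧
  ∀ c : AdaptedChart m' m ι, ContDiffOn ℝ ∞ (fun p => f (c.param p)) c.domain

/-- The zoom action of `s > 0`. -/
noncomputable def zoom (s : ℝ) (hs : 0 < s) : DNC m' m ι → DNC m' m ι
  | generic x t => generic x ((Units.mk0 s hs.ne')⁻¹ * t)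
  | normal x X => normal x (s • X)

/-- Positive homogeneity of degree `a` for the zoom action. -/
def IsHomogeneous (a : ℂ) (f : DNC m' m ι → ℂ) : Prop :=
  ∀ (s : ℝ) (hs : 0 < s) (p : DNC m' m ι), f (zoom s hs p) = (s : ℂ) ^ a * f p

end DNC

/-- The function `t_+^b` on `ℝ^*`. -/
noncomputable def tPlus (b : ℂ) (t : ℝ) : ℂ := if 0 < t then (t : ℂ) ^ b else 0

/-- The function `t_-^b` on `ℝ^*`. -/
noncomputable def tMinus (b : ℂ) (t : ℝ) : ℂ := tPlus b (-t)

/-- `g` and all its derivatives of order at most `k` vanish at the points of `S`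
(in every chart of `M`). -/
def VanishesToOrderOn (m : ℕ) {M : Type*}
    [TopologicalSpace M] [ChartedSpace (EuclideanSpace ℝ (Fin m)) M]
    (k : ℕ) (g : M → ℂ) (S : Set M) : Prop :=
  ∀ p ∈ S, ∀ φ ∈ IsManifold.maximalAtlas (𝓡 m) ∞ M, p ∈ φ.source →
    ∀ j ≤ k, iteratedFDeriv ℝ j (g ∘ φ.symm) (φ p) = 0

/-- `g` is flat on `S`: `g` and all its derivatives vanish on `S`. -/
def IsFlatOn (m : ℕ) {M : Type*}
    [TopologicalSpace M] [ChartedSpace (EuclideanSpace ℝ (Fin m)) M]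
    (g : M → ℂ) (S : Set M) : Prop :=
  ∀ k, VanishesToOrderOn m k g S

/-- The `k`-th derivative of `g` at `p` in the direction `v`, computed in the preferred chart at
`p`, in which the coordinates of `v : TangentSpace (𝓡 m) p` are `v` itself. It does not depend on
the chart, nor on the class of `v` modulo `T_p V`, if `g` vanishes to order `k - 1` on `V`. -/
noncomputable def dirDeriv (m : ℕ) {M : Type*}
    [TopologicalSpace M] [ChartedSpace (EuclideanSpace ℝ (Fin m)) M]
    (k : ℕ) (g : M → ℂ) (p : M) (v : TangentSpace (𝓡 m) p) : ℂ :=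
  iteratedFDeriv ℝ k (g ∘ (extChartAt (𝓡 m) p).symm) (extChartAt (𝓡 m) p p) (fun _ => v)

/-! Homogeneity reduces `f` on `M × ℝ^*` to its slices at `t = 1` and `t = -1`, so everything rests
on how the two slices meet across `t = 0`. Necessity: in an adapted chart, put `F = f ∘ c.param`, so
that `F (y, sξ, s⁻¹t) = s^a F (y, ξ, t)`. A derivative of `F` at `(y, 0, t)`, taken in `r`
directions `ξ` and otherwise in directions `y`, is a function of `t` that is smooth on the whole
line and positively homogeneous of degree `r - a`. Such a function is zero unless `r - a` is a
natural number `n`, and then its values at `-1` and `1` differ by the sign `(-1)^n`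
(`eq_zero_of_homogeneous_aux`). The first fact makes the slices vanish to order `a - 1`, or be flat
when `a` is not an integer. The second makes the signed difference of the slices flat when `a` is an
integer. Sufficiency: if `q` is flat on the slice `ξ = 0`, then `q (y, tξ)` is divisible by every
power of `t`, which absorbs the singularity of `t_±^b` (`contDiffOn_tPlus_mul_deformation`). For an
integer `a`, `f` is `t^{-a} f_{M+}` plus such a flat correction. The function `t^{-a} f_{M+}`
extends smoothly by Hadamard division (`exists_contDiffOn_deformation`). The values over `t = 0` are
limits: Taylor's formula along a curve with velocity `v` gives the `a`-th directional derivative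
(`apply_normal_eq_dirDeriv`). -/

/-! ### Division by powers of a parameter. -/

open Set Filter Topology in
theorem tendsto_div_pow_of_iteratedDeriv_eq_zero {h : ℝ → ℂ} (hh : ContDiffAt ℝ ∞ h 0) (k : ℕ)
    (h0 : ∀ j < k, iteratedDeriv j h 0 = 0) :
    Tendsto (fun t : ℝ => ((t : ℂ) ^ k)⁻¹ * h t) (𝓝[≠] 0)
      (𝓝 (1 / (k.factorial : ℂ) * iteratedDeriv k h 0)) := by
  obtain ⟨u, hu, hu0, hku⟩ :=
    (hh.of_le (m := k) (by exact_mod_cast le_top)).contDiffOn' le_rfl (by simp)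
  simp only [insert_eq_of_mem, mem_univ, univ_inter] at hku
  obtain ⟨ε, hε, hball⟩ := Metric.isOpen_iff.1 hu 0 hu0
  have hmem : (0 : ℝ) ∈ Metric.ball (0 : ℝ) ε := Metric.mem_ball_self hε
  have key := taylor_tendsto (convex_ball (0 : ℝ) ε) hmem (hku.mono hball)
  -- All lower coefficients vanish, so the Taylor polynomial is its top term and the remainder is
  -- `o(t^k)`.
  have hT : ∀ t, taylorWithinEval h k (Metric.ball 0 ε) 0 t =
      (t : ℂ) ^ k * (1 / (k.factorial : ℂ) * iteratedDeriv k h 0) := by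
    intro t
    rw [taylor_within_apply, Finset.sum_range_succ, Finset.sum_eq_zero, zero_add,
      iteratedDerivWithin_of_isOpen Metric.isOpen_ball hmem]
    · simp only [sub_zero, Complex.real_smul]; push_cast; ring
    · intro j hj
      rw [iteratedDerivWithin_of_isOpen Metric.isOpen_ball hmem, h0 j (Finset.mem_range.1 hj),
        smul_zero]
  rw [nhdsWithin_eq_nhds.2 (Metric.isOpen_ball.mem_nhds hmem)] at key
  have key2 := (key.mono_left (nhdsWithin_le_nhds (s := {(0 : ℝ)}ᶜ))).add_const
    (1 / (k.factorial : ℂ) * iteratedDeriv k h 0)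
  rw [zero_add] at key2
  refine key2.congr' ?_
  filter_upwards [self_mem_nhdsWithin] with t ht
  have : (t : ℂ) ^ k ≠ 0 := pow_ne_zero _ (by exact_mod_cast ht)
  rw [hT, sub_zero, Complex.real_smul]
  push_cast
  field_simp
  ring

-- Induction on the order of differentiability, by differentiating under the integral. The target
-- `W` is quantified inside because the derivative takes values in another space, `P →L[ℝ] W`.
universe u in
open MeasureTheory Set Filter Topology in
theorem contDiff_intervalIntegral_param {P : Type u} [NormedAddCommGroup P] [NormedSpace ℝ P]
    [FiniteDimensional ℝ P] (n : ℕ) : ∀ {W : Type u} [NormedAddCommGroup W] [NormedSpace ℝ W]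
    {F : P × ℝ → W}, ContDiff ℝ ∞ F → ContDiff ℝ n (fun p => ∫ r in (0 : ℝ)..1, F (p, r)) := by
  induction n with
  | zero =>
    intro W _ _ F hF
    exact contDiff_zero.2 (intervalIntegral.continuous_parametric_intervalIntegral_of_continuous'
      (by simpa [Function.uncurry_def] using hF.continuous) 0 1)
  | succ n ih =>
    intro W _ _ F hF
    have hdF : ContDiff ℝ ∞
        (fun q : P × ℝ => (fderiv ℝ F q).comp (ContinuousLinearMap.inl ℝ P ℝ)) :=
      (hF.fderiv_right (m := ∞) (by simp)).clm_comp contDiff_const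
    rw [Nat.cast_add, Nat.cast_one, contDiff_succ_iff_hasFDerivAt]
    refine ⟨_, ih hdF, fun p => ?_⟩
    obtain ⟨C, hC⟩ := ((isCompact_closedBall p 1).prod
      (isCompact_Icc (a := (0 : ℝ)) (b := 1))).exists_bound_of_continuousOn
      hdF.continuous.continuousOn
    have hcont : ∀ q : P, Continuous fun r : ℝ => F (q, r) := fun q =>
      hF.continuous.comp (by fun_prop)
    refine intervalIntegral.hasFDerivAt_integral_of_dominated_of_fderiv_le
      (Metric.closedBall_mem_nhds p one_pos) (bound := fun _ => C)
      (.of_forall fun q => (hcont q).aestronglyMeasurable)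
      ((hcont p).intervalIntegrable _ _)
      (hdF.continuous.comp (by fun_prop : Continuous fun r : ℝ => (p, r))).aestronglyMeasurable
      (.of_forall fun r hr q hq => hC (q, r) ⟨hq, ?_⟩) (by simp)
      (.of_forall fun r _ q _ => ?_)
    · rw [uIoc_of_le zero_le_one] at hr
      exact Ioc_subset_Icc_self hr
    · exact ((hF.differentiable (by simp)) (q, r)).hasFDerivAt.comp q
        (hasFDerivAt_prodMk_left q r)

open MeasureTheory Set Filter Topology in
/-- Hadamard's lemma with parameters, for functions defined everywhere. -/
theorem exists_contDiff_eq_mul {P : Type} [NormedAddCommGroup P] [NormedSpace ℝ P]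
    [FiniteDimensional ℝ P] {H : P × ℝ → ℂ} (hH : ContDiff ℝ ∞ H) (h0 : ∀ p, H (p, 0) = 0) :
    ∃ G : P × ℝ → ℂ, ContDiff ℝ ∞ G ∧ ∀ q, H q = (q.2 : ℂ) * G q := by
  have hd : ContDiff ℝ ∞ (fun q : (P × ℝ) × ℝ => fderiv ℝ H (q.1.1, q.2 * q.1.2) (0, 1)) :=
    ((hH.fderiv_right (m := ∞) (by simp)).comp (by fun_prop)).clm_apply contDiff_const
  -- `H (p, t)` is the integral over `r ∈ [0, 1]` of the derivative of `r ↦ H (p, rt)`, which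
  -- carries a factor `t`.
  refine ⟨fun q => ∫ r in (0 : ℝ)..1, fderiv ℝ H (q.1, r * q.2) (0, 1),
    contDiff_infty.2 fun n => contDiff_intervalIntegral_param n hd, fun q => ?_⟩
  have hderiv : ∀ r : ℝ, HasDerivAt (fun r : ℝ => H (q.1, r * q.2))
      ((q.2 : ℂ) * fderiv ℝ H (q.1, r * q.2) (0, 1)) r := by
    intro r
    have h1 : HasDerivAt (fun r : ℝ => (q.1, r * q.2)) ((0, q.2) : P × ℝ) r := by
      simpa using (hasDerivAt_const r q.1).prodMk ((hasDerivAt_id r).mul_const q.2)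
    have := ((hH.differentiable (by simp)) (q.1, r * q.2)).hasFDerivAt.comp_hasDerivAt r h1
    have e : ((0, q.2) : P × ℝ) = q.2 • (0, 1) := by simp
    rw [e, map_smul, Complex.real_smul] at this
    exact this
  have hc : Continuous fun r : ℝ => fderiv ℝ H (q.1, r * q.2) (0, 1) :=
    hd.continuous.comp (by fun_prop : Continuous fun r : ℝ => (q, r))
  have := intervalIntegral.integral_eq_sub_of_hasDerivAt (a := 0) (b := 1)
    (fun r _ => hderiv r) ((continuous_const.mul hc).intervalIntegrable _ _)
  rw [intervalIntegral.integral_const_mul] at this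
  rw [this]
  simp [h0]

-- The quotient is forced: `H / t` off `t = 0`, and `∂H/∂t` on `t = 0`. Smoothness is therefore a
-- local question, and a cutoff reduces it to the case of a function defined everywhere.
open Set Filter Topology in
theorem exists_contDiffOn_eq_mul {P : Type} [NormedAddCommGroup P] [NormedSpace ℝ P]
    [FiniteDimensional ℝ P] {H : P × ℝ → ℂ} {Ω : Set (P × ℝ)} (hΩ : IsOpen Ω)
    (hH : ContDiffOn ℝ ∞ H Ω) (h0 : ∀ p, (p, 0) ∈ Ω → H (p, 0) = 0) :
    ∃ G : P × ℝ → ℂ, ContDiffOn ℝ ∞ G Ω ∧ ∀ q ∈ Ω, H q = (q.2 : ℂ) * G q := by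
  classical
  refine ⟨fun q => if q.2 = 0 then fderiv ℝ H q (0, 1) else (q.2 : ℂ)⁻¹ * H q, ?_, ?_⟩
  · intro q hq
    refine ContDiffAt.contDiffWithinAt ?_
    obtain ⟨p, t⟩ := q
    by_cases ht : t = 0
    · subst ht
      obtain ⟨χ, hχs, -, hχ, -, hχ1⟩ := exists_contDiff_tsupport_subset (n := ⊤) (hΩ.mem_nhds hq)
      have hχH : ContDiff ℝ ∞ fun q => (χ q : ℂ) * H q := by
        refine contDiff_iff_contDiffAt.2 fun q => ?_
        by_cases hq' : q ∈ Ω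
        · exact (Complex.ofRealCLM.contDiff.comp hχ).contDiffAt.mul
            (hH.contDiffAt (hΩ.mem_nhds hq'))
        · refine (contDiffAt_const (c := (0 : ℂ))).congr_of_eventuallyEq ?_
          filter_upwards [notMem_tsupport_iff_eventuallyEq.1 fun h => hq' (hχs h)] with r hr
          simp [hr]
      obtain ⟨G, hG, hGH⟩ := exists_contDiff_eq_mul hχH fun p => by
        by_cases hp : (p, (0 : ℝ)) ∈ Ω
        · simp [h0 p hp]
        · simp [image_eq_zero_of_notMem_tsupport fun h => hp (hχs h)]
      -- The cutoff is only known to be `1` at the centre, so it is divided out where it is nonzero.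
      have hquot : ∀ q, χ q ≠ 0 → ContDiffAt ℝ ∞ (fun q => (χ q : ℂ)⁻¹ * G q) q := fun q hq' =>
        ((Complex.ofRealCLM.contDiff.comp hχ).contDiffAt.inv (by simpa using hq')).mul
          hG.contDiffAt
      refine (hquot _ (by simp [hχ1])).congr_of_eventuallyEq ?_
      filter_upwards [hΩ.mem_nhds hq, hχ.continuous.continuousAt.eventually_ne
        (show χ (p, 0) ≠ 0 by simp [hχ1])] with ⟨p', t⟩ hp' hχp'
      have hHG : ∀ q, χ q ≠ 0 → H q = (q.2 : ℂ) * ((χ q : ℂ)⁻¹ * G q) := fun q hq' => by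
        have := hGH q
        have h2 : (χ q : ℂ) ≠ 0 := by exact_mod_cast hq'
        field_simp
        linear_combination this
      by_cases ht : t = 0
      · subst ht
        simp only [if_true]
        have hc : HasDerivAt (fun r : ℝ => (p', r)) ((0, 1) : P × ℝ) 0 :=
          (hasDerivAt_const _ p').prodMk (hasDerivAt_id _)
        have h1 := ((hH.contDiffAt (hΩ.mem_nhds hp')).differentiableAt
          (by simp)).hasFDerivAt.comp_hasDerivAt (0 : ℝ) hc
        have h2 := ((hquot (p', 0) hχp').differentiableAt
          (by simp)).hasFDerivAt.comp_hasDerivAt (0 : ℝ) hc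
        have h3 := (Complex.ofRealCLM.hasDerivAt (x := (0 : ℝ))).mul h2
        refine h1.unique ((h3.congr_of_eventuallyEq ?_).congr_deriv ?_)
        · have := (hχ.continuous.comp (by fun_prop : Continuous fun r : ℝ => (p', r))
            ).continuousAt.eventually_ne (x := (0 : ℝ)) (show χ (p', 0) ≠ 0 from hχp')
          filter_upwards [this] with r hr
          exact hHG _ hr
        · simp
      · have : (t : ℂ) ≠ 0 := by exact_mod_cast ht
        simp [ht, hHG _ hχp', this]
    · have : (fun q : P × ℝ => (q.2 : ℂ)⁻¹ * H q) =ᶠ[𝓝 (p, t)]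
          fun q => if q.2 = 0 then fderiv ℝ H q (0, 1) else (q.2 : ℂ)⁻¹ * H q := by
        filter_upwards [(continuous_snd.isOpen_preimage _ isOpen_compl_singleton).mem_nhds
          (show (p, t) ∈ Prod.snd ⁻¹' {0}ᶜ from ht)] with q hq'
        rw [if_neg (by simpa using hq')]
      refine ContDiffAt.congr_of_eventuallyEq ?_ this.symm
      refine ContDiffAt.mul (ContDiffAt.inv ?_ (by simpa using ht))
        (hH.contDiffAt (hΩ.mem_nhds hq))
      exact (Complex.ofRealCLM.contDiff.comp contDiff_snd).contDiffAt
  · rintro ⟨p, t⟩ hq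
    by_cases ht : t = 0
    · subst ht; simp [h0 p hq]
    · have : (t : ℂ) ≠ 0 := by exact_mod_cast ht
      simp [ht, this]

open Set Filter Topology in
/-- Division by a power of the parameter of a function that vanishes to high order with it. -/
theorem exists_contDiffOn_eq_pow_mul {P : Type} [NormedAddCommGroup P] [NormedSpace ℝ P]
    [FiniteDimensional ℝ P] {H : P × ℝ → ℂ} {Ω : Set (P × ℝ)} (hΩ : IsOpen Ω)
    (hH : ContDiffOn ℝ ∞ H Ω) (k : ℕ)
    (h0 : ∀ p, (p, 0) ∈ Ω → ∀ j < k, iteratedDeriv j (fun t : ℝ => H (p, t)) 0 = 0) :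
    ∃ G : P × ℝ → ℂ, ContDiffOn ℝ ∞ G Ω ∧ ∀ q ∈ Ω, H q = (q.2 : ℂ) ^ k * G q := by
  induction k with
  | zero => exact ⟨H, hH, by simp⟩
  | succ k ih =>
    obtain ⟨G, hG, hHG⟩ := ih fun p hp j hj => h0 p hp j (by omega)
    obtain ⟨G', hG', hGG'⟩ := exists_contDiffOn_eq_mul hΩ hG fun p hp => by
      have hline : ContDiff ℝ ∞ fun t : ℝ => (p, t) := by fun_prop
      -- The quotient by `t^k` takes at `t = 0` the `k`-th Taylor coefficient of `H`, which vanishes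
      -- by hypothesis; one more factor `t` can be extracted.
      have h1 := tendsto_div_pow_of_iteratedDeriv_eq_zero
        ((hH.contDiffAt (hΩ.mem_nhds hp)).comp (0 : ℝ) hline.contDiffAt) k
        fun j hj => h0 p hp j (by omega)
      have h2 : Tendsto (fun t : ℝ => G (p, t)) (𝓝[≠] 0) (𝓝 (G (p, 0))) :=
        ((hG.contDiffAt (hΩ.mem_nhds hp)).continuousAt.comp
          hline.continuous.continuousAt).tendsto.mono_left nhdsWithin_le_nhds
      have h3 := tendsto_nhds_unique h2 (h1.congr' ?_)
      · rw [h3]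
        have := h0 p hp k (by omega)
        simp only [Function.comp_def]
        rw [this, mul_zero]
      · have hnear : ∀ᶠ t : ℝ in 𝓝 0, (p, t) ∈ Ω :=
          hline.continuous.continuousAt.eventually_mem (hΩ.mem_nhds hp)
        filter_upwards [self_mem_nhdsWithin, hnear.filter_mono nhdsWithin_le_nhds] with t ht htΩ
        have : (t : ℂ) ^ k ≠ 0 := pow_ne_zero _ (by exact_mod_cast ht)
        simp only [Function.comp_def]
        rw [hHG _ htΩ]
        field_simp
    exact ⟨G', hG', fun q hq => by rw [hHG q hq, hGG' q hq]; ring⟩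

/-! ### Regularity of the functions `t_+^b`. -/

theorem tPlus_of_nonpos (b : ℂ) {t : ℝ} (ht : t ≤ 0) : tPlus b t = 0 := if_neg ht.not_gt

theorem tPlus_of_pos (b : ℂ) {t : ℝ} (ht : 0 < t) : tPlus b t = (t : ℂ) ^ b := if_pos ht

theorem tPlus_add_natCast (b : ℂ) (n : ℕ) (t : ℝ) :
    tPlus (b + n) t = tPlus b t * (t : ℂ) ^ n := by
  unfold tPlus
  split_ifs with h
  · rw [Complex.cpow_add _ _ (by exact_mod_cast h.ne'), Complex.cpow_natCast]
  · simp

open Set Filter Topology in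
theorem tendsto_tPlus_nhds_zero {b : ℂ} (hb : 0 < b.re) : Tendsto (tPlus b) (𝓝 0) (𝓝 0) := by
  have hc : Tendsto (fun t : ℝ => |t| ^ b.re) (𝓝 0) (𝓝 0) := by
    have : ContinuousAt (fun t : ℝ => |t| ^ b.re) 0 :=
      continuous_abs.continuousAt.rpow_const (Or.inr hb.le)
    simpa [ContinuousAt, Real.zero_rpow hb.ne'] using this
  refine squeeze_zero_norm (fun t => ?_) hc
  unfold tPlus
  split_ifs with h
  · rw [Complex.norm_cpow_eq_rpow_re_of_pos h, abs_of_pos h]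
  · simpa using Real.rpow_nonneg (abs_nonneg t) _

open Set Filter Topology in
theorem hasDerivAt_tPlus_of_ne (b : ℂ) {t : ℝ} (ht : t ≠ 0) :
    HasDerivAt (tPlus b) (b * tPlus (b - 1) t) t := by
  rcases ht.lt_or_gt with h | h
  · rw [tPlus_of_nonpos _ h.le, mul_zero]
    refine (hasDerivAt_const t (0 : ℂ)).congr_of_eventuallyEq ?_
    filter_upwards [Iio_mem_nhds h] with s hs using tPlus_of_nonpos _ (le_of_lt hs)
  · rw [tPlus_of_pos _ h]
    have h1 : HasDerivAt (fun s : ℝ => (s : ℂ) ^ b) (b * (t : ℂ) ^ (b - 1)) t := by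
      have := ((hasDerivAt_id (t : ℂ)).cpow_const (c := b)
        (Complex.ofReal_mem_slitPlane.2 h)).comp_ofReal
      simpa using this
    refine h1.congr_of_eventuallyEq ?_
    filter_upwards [Ioi_mem_nhds h] with s hs using tPlus_of_pos _ hs

open Set Filter Topology in
theorem contDiff_tPlus (n : ℕ) : ∀ {b : ℂ}, (n : ℝ) < b.re → ContDiff ℝ n (tPlus b) := by
  have hcont : ∀ b : ℂ, 0 < b.re → Continuous (tPlus b) := fun b hb =>
    continuous_iff_continuousAt.2 fun t => by
      by_cases ht : t = 0
      · subst ht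
        simpa [ContinuousAt, tPlus] using tendsto_tPlus_nhds_zero hb
      · exact (hasDerivAt_tPlus_of_ne b ht).continuousAt
  induction n with
  | zero => exact fun {b} hb => contDiff_zero.2 (hcont b (by simpa using hb))
  | succ n ih =>
    intro b hb
    have hb1 : (n : ℝ) < (b - 1).re := by simpa [lt_sub_iff_add_lt] using hb
    have hn : (0 : ℝ) ≤ n := n.cast_nonneg
    have hder : ∀ t, HasDerivAt (tPlus b) (b * tPlus (b - 1) t) t := fun t => by
      by_cases ht : t = 0
      · subst ht
        -- The slope of `t_+^b` at `0` is `t_+^{b-1}`, which tends to `0` because `Re (b - 1) > n ≥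
        -- 0`.
        rw [hasDerivAt_iff_tendsto_slope, tPlus_of_nonpos _ le_rfl, mul_zero]
        refine ((tendsto_tPlus_nhds_zero (b := b - 1) (hn.trans_lt hb1)).mono_left
          nhdsWithin_le_nhds).congr' ?_
        filter_upwards [self_mem_nhdsWithin] with t ht
        have ht' : (t : ℂ) ≠ 0 := by exact_mod_cast ht
        have := tPlus_add_natCast (b - 1) 1 t
        simp only [Nat.cast_one, sub_add_cancel, pow_one] at this
        simp only [slope_def_module, sub_zero, tPlus_of_nonpos b le_rfl, this, Complex.real_smul]
        push_cast
        field_simp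
      · exact hasDerivAt_tPlus_of_ne b ht
    rw [Nat.cast_add, Nat.cast_one, contDiff_succ_iff_deriv]
    refine ⟨fun t => (hder t).differentiableAt, by simp, ?_⟩
    rw [funext fun t => (hder t).deriv]
    exact contDiff_const.mul (ih hb1)

open Set Filter Topology in
theorem contDiffAt_tPlus (b : ℂ) {t : ℝ} (ht : t ≠ 0) : ContDiffAt ℝ ∞ (tPlus b) t := by
  rcases ht.lt_or_gt with h | h
  · refine (contDiffAt_const (c := (0 : ℂ))).congr_of_eventuallyEq ?_
    filter_upwards [Iio_mem_nhds h] with s hs using tPlus_of_nonpos _ (le_of_lt hs)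
  · have h1 : ContDiffAt ℝ ∞ (fun s : ℝ => Complex.exp (Real.log s * b)) t :=
      ((Complex.ofRealCLM.contDiff.contDiffAt.comp t
        (Real.contDiffAt_log.2 h.ne')).mul contDiffAt_const).cexp
    refine h1.congr_of_eventuallyEq ?_
    filter_upwards [Ioi_mem_nhds h] with s hs
    have hs0 : s ≠ 0 := (show 0 < s from hs).ne'
    rw [tPlus_of_pos _ hs, Complex.cpow_def_of_ne_zero (by exact_mod_cast hs0),
      Complex.ofReal_log (le_of_lt hs)]

/-! ### Smooth homogeneous functions on the line. -/

open Set Filter Topology in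
/-- A smooth function on the line which is positively homogeneous is a monomial. -/
theorem eq_zero_of_homogeneous_aux (N : ℕ) : ∀ {b : ℂ} {u : ℝ → ℂ}, b.re < N →
    ContDiff ℝ ∞ u → (∀ s t : ℝ, 0 < s → u (s * t) = (s : ℂ) ^ b * u t) →
    ((∀ n : ℕ, b ≠ n) → ∀ t, u t = 0) ∧ ∀ n : ℕ, b = n → u (-1) = (-1) ^ n * u 1 := by
  induction N with
  | zero =>
    intro b u hb hu h
    have hu0 : ∀ t, u t = 0 := by
      intro t
      -- For `Re b < 0`, the quantity `s^{-b} u(st)` is constantly `u t`, yet tends to `0 * u 0` as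
      -- `s → 0⁺`.
      have h1 : Tendsto (fun s : ℝ => tPlus (-b) s * u (s * t)) (𝓝[>] 0) (𝓝 (0 * u (0 * t))) :=
        ((tendsto_tPlus_nhds_zero (by simpa using hb)).mul
          ((hu.continuous.comp (by fun_prop : Continuous fun s : ℝ => s * t)).tendsto 0)).mono_left
          nhdsWithin_le_nhds
      rw [zero_mul] at h1
      refine tendsto_nhds_unique (tendsto_const_nhds.congr' ?_) h1
      filter_upwards [self_mem_nhdsWithin] with s hs
      have hs0 : (s : ℂ) ≠ 0 := by exact_mod_cast (show 0 < s from hs).ne'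
      rw [tPlus_of_pos _ hs, h s t hs, ← mul_assoc, ← Complex.cpow_add _ _ hs0]
      simp
    exact ⟨fun _ => hu0, fun n _ => by simp [hu0]⟩
  | succ N ih =>
    intro b u hb hu h
    have hdu : ∀ t, HasDerivAt u (deriv u t) t := fun t =>
      (hu.differentiable (by simp) t).hasDerivAt
    have h' : ∀ s t : ℝ, 0 < s → deriv u (s * t) = (s : ℂ) ^ (b - 1) * deriv u t := by
      intro s t hs
      have hs0 : (s : ℂ) ≠ 0 := by exact_mod_cast hs.ne'
      have e1 : HasDerivAt (fun t => u (s * t)) ((s : ℂ) * deriv u (s * t)) t := by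
        simpa [Function.comp_def] using (hdu (s * t)).scomp t ((hasDerivAt_id t).const_mul s)
      have e2 : HasDerivAt (fun t => u (s * t)) ((s : ℂ) ^ b * deriv u t) t := by
        simpa only [h _ _ hs] using (hdu t).const_mul ((s : ℂ) ^ b)
      have e3 := e1.unique e2
      rw [Complex.cpow_sub _ _ hs0, Complex.cpow_one]
      field_simp
      linear_combination e3
    -- The derivative is homogeneous of degree `b - 1`; Euler's identity brings the induction
    -- hypothesis for it back to `u` when `b ≠ 0`. For `b = 0`, `u'` vanishes and `u` is constant.
    have euler : ∀ t : ℝ, (t : ℂ) * deriv u t = b * u t := by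
      intro t
      have e1 : HasDerivAt (fun s : ℝ => u (s * t)) ((t : ℂ) * deriv u t) 1 := by
        have := (hdu (1 * t)).scomp (1 : ℝ) ((hasDerivAt_id (1 : ℝ)).mul_const t)
        simpa [Function.comp_def] using this
      have e2 : HasDerivAt (fun s : ℝ => tPlus b s * u t) (b * tPlus (b - 1) 1 * u t) 1 :=
        (hasDerivAt_tPlus_of_ne b one_ne_zero).mul_const _
      rw [tPlus_of_pos _ one_pos, Complex.ofReal_one, Complex.one_cpow, mul_one] at e2
      refine e1.unique (e2.congr_of_eventuallyEq ?_)
      filter_upwards [Ioi_mem_nhds one_pos] with s hs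
      rw [h s t hs, tPlus_of_pos _ hs]
    obtain ⟨i1, i2⟩ := ih (b := b - 1) (u := deriv u)
      (by simpa [sub_lt_iff_lt_add] using hb) ((contDiff_infty_iff_deriv.1 hu).2) h'
    refine ⟨fun hn => ?_, fun n hn => ?_⟩
    · have hz := i1 fun n e => hn (n + 1) (by push_cast; linear_combination e)
      intro t
      have := euler t
      rw [hz, mul_zero] at this
      exact (mul_eq_zero.1 this.symm).resolve_left (by simpa using hn 0)
    · cases n with
      | zero =>
        have hz := i1 fun n e => by
          have : ((n + 1 : ℕ) : ℂ) = 0 := by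
            push_cast; rw [← e, hn]; simp
          exact absurd this (by exact_mod_cast n.succ_ne_zero)
        have := is_const_of_deriv_eq_zero (hu.differentiable (by simp)) hz (-1) 1
        simpa using this
      | succ n =>
        have e := i2 n (by rw [hn]; push_cast; ring)
        have e1 := euler 1
        have e2 := euler (-1)
        have hb0 : b ≠ 0 := by rw [hn]; exact_mod_cast n.succ_ne_zero
        push_cast at e1 e2
        refine mul_left_cancel₀ hb0 ?_
        rw [pow_succ]
        linear_combination (-1 : ℂ) * e2 - e - (-1) ^ n * e1

theorem eq_zero_of_homogeneous {b : ℂ} {u : ℝ → ℂ} (hu : ContDiff ℝ ∞ u)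
    (h : ∀ s t : ℝ, 0 < s → u (s * t) = (s : ℂ) ^ b * u t) (hb : ∀ n : ℕ, b ≠ n) (t : ℝ) :
    u t = 0 := by
  obtain ⟨N, hN⟩ := exists_nat_gt b.re
  exact (eq_zero_of_homogeneous_aux N hN hu h).1 hb t

theorem apply_neg_one_of_homogeneous {n : ℕ} {u : ℝ → ℂ} (hu : ContDiff ℝ ∞ u)
    (h : ∀ s t : ℝ, 0 < s → u (s * t) = (s : ℂ) ^ (n : ℂ) * u t) : u (-1) = (-1) ^ n * u 1 :=
  (eq_zero_of_homogeneous_aux (n + 1) (by simp) hu h).2 n rfl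

/-! ### Higher derivatives under composition. -/

theorem iteratedFDeriv_comp_affine {E F W : Type*} [NormedAddCommGroup E] [NormedSpace ℝ E]
    [NormedAddCommGroup F] [NormedSpace ℝ F] [NormedAddCommGroup W] [NormedSpace ℝ W]
    {f : F → W} (A : E →L[ℝ] F) (c : F) {x : E} (hf : ContDiffAt ℝ ∞ f (A x + c)) (j : ℕ) :
    iteratedFDeriv ℝ j (fun z => f (A z + c)) x =
      (iteratedFDeriv ℝ j f (A x + c)).compContinuousLinearMap fun _ => A := by
  obtain ⟨u, hu, hxu, hfu⟩ :=
    (hf.of_le (m := j) (by exact_mod_cast le_top)).contDiffOn' le_rfl (by simp)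
  simp only [Set.insert_eq_of_mem, Set.mem_univ, Set.univ_inter] at hfu
  have hcont : Continuous fun y : F => y + c := by fun_prop
  have hv : IsOpen ((fun y => y + c) ⁻¹' u) := hu.preimage hcont
  have hxv : A x ∈ (fun y => y + c) ⁻¹' u := hxu
  have hg : ContDiffOn ℝ j (fun y => f (y + c)) ((fun y => y + c) ⁻¹' u) :=
    hfu.comp (by fun_prop) fun _ h => h
  have hA : IsOpen (A ⁻¹' ((fun y => y + c) ⁻¹' u)) := hv.preimage A.continuous
  have := A.iteratedFDerivWithin_comp_right hg hv.uniqueDiffOn hA.uniqueDiffOn hxv le_rfl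
  rw [iteratedFDerivWithin_of_isOpen j hA hxv, iteratedFDerivWithin_of_isOpen j hv hxv,
    iteratedFDeriv_comp_add_right] at this
  exact this

theorem iteratedDeriv_comp_line {F W : Type*} [NormedAddCommGroup F] [NormedSpace ℝ F]
    [NormedAddCommGroup W] [NormedSpace ℝ W] {f : F → W} {x : F} (v : F)
    (hf : ContDiffAt ℝ ∞ f x) (j : ℕ) :
    iteratedDeriv j (fun t : ℝ => f (t • v + x)) 0 = iteratedFDeriv ℝ j f x fun _ => v := by
  have h := iteratedFDeriv_comp_affine (f := f) (ContinuousLinearMap.toSpanSingleton ℝ v) x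
    (x := 0) (by simpa using hf) j
  simp only [ContinuousLinearMap.toSpanSingleton_apply, zero_smul, zero_add] at h
  rw [iteratedDeriv_eq_iteratedFDeriv, h]
  simp

/-- Vanishing to a given order at a point is stable under pull-back by smooth maps. -/
theorem iteratedFDeriv_comp_eq_zero {E F W : Type*} [NormedAddCommGroup E] [NormedSpace ℝ E]
    [NormedAddCommGroup F] [NormedSpace ℝ F] [NormedAddCommGroup W] [NormedSpace ℝ W]
    {g : F → W} {h : E → F} {x : E} (hg : ContDiffAt ℝ ∞ g (h x)) (hh : ContDiffAt ℝ ∞ h x)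
    {k : ℕ} (h0 : ∀ j ≤ k, iteratedFDeriv ℝ j g (h x) = 0) :
    iteratedFDeriv ℝ k (g ∘ h) x = 0 := by
  obtain ⟨t, ht, hxt, hgt⟩ :=
    (hg.of_le (m := k) (by exact_mod_cast le_top)).contDiffOn' le_rfl (by simp)
  obtain ⟨s, hs, hxs, hhs⟩ :=
    (hh.of_le (m := k) (by exact_mod_cast le_top)).contDiffOn' le_rfl (by simp)
  simp only [Set.insert_eq_of_mem, Set.mem_univ, Set.univ_inter] at hgt hhs
  have hs' : IsOpen (s ∩ h ⁻¹' t) := hhs.continuousOn.isOpen_inter_preimage hs ht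
  have hxs' : x ∈ s ∩ h ⁻¹' t := ⟨hxs, hxt⟩
  -- The Faà di Bruno norm bound is applied with `C = 0`. It asks for the `i`-th derivative of `h`
  -- to be at most `D ^ i`; the summand `1` gives `D ≤ D ^ i` for `i ≥ 1`.
  set D : ℝ := 1 + ∑ i ∈ Finset.range (k + 1), ‖iteratedFDeriv ℝ i h x‖ with hD
  have hsum : (0 : ℝ) ≤ ∑ i ∈ Finset.range (k + 1), ‖iteratedFDeriv ℝ i h x‖ :=
    Finset.sum_nonneg fun _ _ => norm_nonneg _
  have := norm_iteratedFDerivWithin_comp_le (C := 0) (D := D) hgt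
    (hhs.mono Set.inter_subset_left) le_rfl ht.uniqueDiffOn hs'.uniqueDiffOn (fun _ hy => hy.2)
    hxs' (fun i hi => by rw [iteratedFDerivWithin_of_isOpen i ht hxt, h0 i hi, norm_zero])
    (fun i hi hik => by
      rw [iteratedFDerivWithin_of_isOpen i hs' hxs']
      have h1 : ‖iteratedFDeriv ℝ i h x‖ ≤ D := by
        have := Finset.single_le_sum (f := fun i => ‖iteratedFDeriv ℝ i h x‖)
          (fun _ _ => norm_nonneg _) (Finset.mem_range.2 (Nat.lt_succ_of_le hik))
        linarith
      exact h1.trans (le_self_pow₀ (by linarith) (by omega)))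
  rw [iteratedFDerivWithin_of_isOpen k hs' hxs', mul_zero, zero_mul] at this
  exact norm_le_zero_iff.1 this

/-- Reduces the vanishing of a derivative to arguments that are purely tangential or purely normal,
on which the zoom acts by scalars. -/
theorem ContinuousMultilinearMap.eq_zero_of_prod {j : ℕ} {E₁ E₂ W : Type*}
    [NormedAddCommGroup E₁] [NormedSpace ℝ E₁] [NormedAddCommGroup E₂] [NormedSpace ℝ E₂]
    [NormedAddCommGroup W] [NormedSpace ℝ W]
    (T : ContinuousMultilinearMap ℝ (fun _ : Fin j => E₁ × E₂) W)
    (h : ∀ (S : Finset (Fin j)) (v : Fin j → E₁ × E₂),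
      T (S.piecewise (fun i => (0, (v i).2)) fun i => ((v i).1, 0)) = 0) : T = 0 := by
  ext v
  have e : v = (fun i => ((0 : E₁), (v i).2)) + fun i => ((v i).1, (0 : E₂)) := by
    ext i <;> simp
  rw [e, T.map_add_univ]
  exact Finset.sum_eq_zero fun S _ => h S v

/-! ### The local model: the slice `ξ = 0` in a product. -/

section Slice

variable {E₁ E₂ : Type} [NormedAddCommGroup E₁] [NormedSpace ℝ E₁] [FiniteDimensional ℝ E₁]
  [NormedAddCommGroup E₂] [NormedSpace ℝ E₂] [FiniteDimensional ℝ E₂]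

/-- The set of the `(y, ξ, t)` such that `(y, t ξ)` belongs to `U`. -/
def deformationDomain (U : Set (E₁ × E₂)) : Set (E₁ × E₂ × ℝ) :=
  {p | (p.1, p.2.2 • p.2.1) ∈ U}

omit [NormedSpace ℝ E₁] [FiniteDimensional ℝ E₁] [FiniteDimensional ℝ E₂] in
theorem isOpen_deformationDomain {U : Set (E₁ × E₂)} (hU : IsOpen U) :
    IsOpen (deformationDomain U) :=
  hU.preimage (by fun_prop)

theorem exists_contDiffOn_deformation {U : Set (E₁ × E₂)} (hU : IsOpen U) {q : E₁ × E₂ → ℂ}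
    (hq : ContDiffOn ℝ ∞ q U) (k : ℕ)
    (h0 : ∀ y, (y, 0) ∈ U → ∀ j < k, iteratedFDeriv ℝ j q (y, 0) = 0) :
    ∃ G : E₁ × E₂ × ℝ → ℂ, ContDiffOn ℝ ∞ G (deformationDomain U) ∧
      ∀ p ∈ deformationDomain U, q (p.1, p.2.2 • p.2.1) = (p.2.2 : ℂ) ^ k * G p := by
  set e := ContinuousLinearEquiv.prodAssoc ℝ E₁ E₂ ℝ
  have hΩ := isOpen_deformationDomain hU
  obtain ⟨G, hG, hqG⟩ := exists_contDiffOn_eq_pow_mul (Ω := e ⁻¹' deformationDomain U)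
    (H := fun r => q (r.1.1, r.2 • r.1.2)) (hΩ.preimage e.continuous)
    (hq.comp (s := e ⁻¹' deformationDomain U) (f := fun r : (E₁ × E₂) × ℝ => (r.1.1, r.2 • r.1.2))
      (by fun_prop) fun _ h => h) k (fun r hr j hj => by
      have hr' : (r.1, (0 : E₂)) ∈ U := by simpa [e, deformationDomain] using hr
      -- The `j`-th derivative of `t ↦ q (y, tξ)` at `0` is `D^j q (y, 0)` on copies of `(0, ξ)`.
      have := iteratedDeriv_comp_line (f := q) (x := (r.1, 0)) (0, r.2)
        (hq.contDiffAt (hU.mem_nhds hr')) j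
      simp only [Prod.smul_mk, smul_zero, Prod.mk_add_mk, zero_add, add_zero] at this
      rw [this, h0 _ hr' j hj]
      rfl)
  refine ⟨fun p => G (e.symm p), hG.comp e.symm.contDiff.contDiffOn fun p hp => ?_,
    fun p hp => ?_⟩
  · simpa using hp
  · exact hqG (e.symm p) (by simpa using hp)

theorem contDiffOn_tPlus_mul_deformation {U : Set (E₁ × E₂)} (hU : IsOpen U) {q : E₁ × E₂ → ℂ}
    (hq : ContDiffOn ℝ ∞ q U) (h0 : ∀ y, (y, 0) ∈ U → ∀ j, iteratedFDeriv ℝ j q (y, 0) = 0)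
    (b : ℂ) : ContDiffOn ℝ ∞ (fun p : E₁ × E₂ × ℝ => tPlus b p.2.2 * q (p.1, p.2.2 • p.2.1))
      (deformationDomain U) := by
  refine contDiffOn_infty.2 fun n => ?_
  -- Extracting `t^N` from `q (y, tξ)` raises the exponent to `b + N`, whose real part exceeds `n`;
  -- this yields class `C^n` for each `n`.
  obtain ⟨N, hN⟩ := exists_nat_gt (n - b.re)
  obtain ⟨G, hG, hqG⟩ := exists_contDiffOn_deformation hU hq N fun y hy j _ => h0 y hy j
  have ht : ContDiff ℝ n (tPlus (b + N)) := contDiff_tPlus n (by simpa using by linarith)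
  refine ContDiffOn.congr (f := fun p : E₁ × E₂ × ℝ => tPlus (b + N) p.2.2 * G p)
    ((ht.comp (by fun_prop : ContDiff ℝ n fun p : E₁ × E₂ × ℝ => p.2.2)).contDiffOn.mul
      (hG.of_le (by exact_mod_cast le_top))) fun p hp => ?_
  rw [hqG p hp, tPlus_add_natCast]
  ring

/-- The reflection `(y, ξ, t) ↦ (y, -ξ, -t)` fixes `(y, tξ)` and exchanges `t_+` and `t_-`. -/
theorem contDiffOn_tMinus_mul_deformation {U : Set (E₁ × E₂)} (hU : IsOpen U) {q : E₁ × E₂ → ℂ}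
    (hq : ContDiffOn ℝ ∞ q U) (h0 : ∀ y, (y, 0) ∈ U → ∀ j, iteratedFDeriv ℝ j q (y, 0) = 0)
    (b : ℂ) : ContDiffOn ℝ ∞ (fun p : E₁ × E₂ × ℝ => tMinus b p.2.2 * q (p.1, p.2.2 • p.2.1))
      (deformationDomain U) := by
  have h := (contDiffOn_tPlus_mul_deformation hU hq h0 b).comp
    (by fun_prop : ContDiff ℝ ∞ fun p : E₁ × E₂ × ℝ => (p.1, -p.2.1, -p.2.2)).contDiffOn
    (s := deformationDomain U) fun p hp => by simpa [deformationDomain] using hp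
  simpa [Function.comp_def, tMinus] using h

section Homogeneous

variable {U : Set (E₁ × E₂)} {F : E₁ × E₂ × ℝ → ℂ} {a : ℂ} {y : E₁} {j : ℕ}

omit [FiniteDimensional ℝ E₁] [FiniteDimensional ℝ E₂]

/-- `S` records the normal arguments. Differentiating the homogeneity relation gives one factor `s`
for each of them; the points `(y, 0, t)` are used because the zoom moves only their `t`. -/
theorem iteratedFDeriv_homogeneous (hU : IsOpen U) (hFs : ContDiffOn ℝ ∞ F (deformationDomain U))
    (hF : ∀ (s : ℝ), 0 < s → ∀ p : E₁ × E₂ × ℝ, F (p.1, s • p.2.1, s⁻¹ * p.2.2) = (s : ℂ) ^ a * F p)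
    (hy : (y, 0) ∈ U) (S : Finset (Fin j)) (v : Fin j → E₁ × E₂) (s t : ℝ) (hs : 0 < s) :
    iteratedFDeriv ℝ j F (y, 0, s * t)
        (S.piecewise (fun i => (0, (v i).2, 0)) fun i => ((v i).1, 0, 0)) =
      (s : ℂ) ^ ((S.card : ℂ) - a) * iteratedFDeriv ℝ j F (y, 0, t)
        (S.piecewise (fun i => (0, (v i).2, 0)) fun i => ((v i).1, 0, 0)) := by
  set w : Fin j → E₁ × E₂ × ℝ := S.piecewise (fun i => (0, (v i).2, 0)) fun i => ((v i).1, 0, 0)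
    with hw
  have hs0 : (s : ℂ) ≠ 0 := by exact_mod_cast hs.ne'
  have hsm : ∀ t, ContDiffAt ℝ ∞ F (y, 0, t) := fun t =>
    hFs.contDiffAt ((isOpen_deformationDomain hU).mem_nhds (by simpa [deformationDomain] using hy))
  -- The zoom by `s⁻¹`, so that `t` is sent to `st`.
  let B : (E₁ × E₂ × ℝ) →L[ℝ] (E₁ × E₂ × ℝ) :=
    (ContinuousLinearMap.id ℝ E₁).prodMap
      ((s⁻¹ • ContinuousLinearMap.id ℝ E₂).prodMap (s • ContinuousLinearMap.id ℝ ℝ))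
  have hB : ∀ p, B p = (p.1, s⁻¹ • p.2.1, s * p.2.2) := fun p => rfl
  have hFB : (fun p => F (B p + 0)) = fun p => ((s : ℂ) ^ (-a)) • F p := by
    ext p
    have := hF s⁻¹ (inv_pos.2 hs) p
    simp only [inv_inv] at this
    rw [add_zero, hB, this, Complex.ofReal_inv, smul_eq_mul,
      Complex.inv_cpow _ _ (by rw [Complex.arg_ofReal_of_nonneg hs.le]; exact Real.pi_pos.ne),
      Complex.cpow_neg]
  have hBw : ∀ i, B (w i) = (if i ∈ S then s⁻¹ else 1) • w i := by
    intro i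
    by_cases hi : i ∈ S <;> simp [hw, hB, hi]
  have h1 := iteratedFDeriv_comp_affine (f := F) B 0 (x := (y, 0, t))
    (by simpa [hB] using hsm (s * t)) j
  rw [hFB, iteratedFDeriv_const_smul_apply' ((hsm t).of_le (by exact_mod_cast le_top)),
    add_zero, hB] at h1
  have h2 := congrArg (fun T => T w) h1
  simp only [smul_zero, smul_apply,
    ContinuousMultilinearMap.compContinuousLinearMap_apply, hBw,
    ContinuousMultilinearMap.map_smul_univ, Finset.prod_ite_mem, Finset.univ_inter,
    Finset.prod_const, Complex.real_smul, smul_eq_mul] at h2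
  push_cast at h2
  rw [Complex.cpow_sub _ _ hs0, Complex.cpow_natCast]
  rw [Complex.cpow_neg] at h2
  have hp : (s : ℂ) ^ S.card * ((s : ℂ)⁻¹) ^ S.card = 1 := by
    rw [← mul_pow, mul_inv_cancel₀ hs0, one_pow]
  linear_combination (-(s : ℂ) ^ S.card) * h2 -
    iteratedFDeriv ℝ j F (y, 0, s * t) w * hp

theorem contDiff_iteratedFDeriv_apply (hU : IsOpen U)
    (hFs : ContDiffOn ℝ ∞ F (deformationDomain U)) (hy : (y, 0) ∈ U)
    (w : Fin j → E₁ × E₂ × ℝ) :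
    ContDiff ℝ ∞ fun t : ℝ => iteratedFDeriv ℝ j F (y, 0, t) w := by
  refine contDiff_iff_contDiffAt.2 fun t => ?_
  have hsm : ContDiffAt ℝ ∞ F (y, 0, t) :=
    hFs.contDiffAt ((isOpen_deformationDomain hU).mem_nhds (by simpa [deformationDomain] using hy))
  have h1 : ContDiffAt ℝ ∞ (iteratedFDeriv ℝ j F) (y, 0, t) :=
    hsm.iteratedFDeriv_right (m := ∞) (i := j) (by exact_mod_cast le_rfl)
  have hl : ContDiff ℝ ∞ fun t : ℝ => (y, (0 : E₂), t) := by fun_prop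
  exact (ContinuousMultilinearMap.apply ℝ (fun _ : Fin j => E₁ × E₂ × ℝ) ℂ
    w).contDiff.contDiffAt.comp t (h1.comp t hl.contDiffAt)

theorem iteratedFDeriv_restrict (hU : IsOpen U) (hFs : ContDiffOn ℝ ∞ F (deformationDomain U))
    (hy : (y, 0) ∈ U) (S : Finset (Fin j)) (v : Fin j → E₁ × E₂) (c d : ℝ) :
    iteratedFDeriv ℝ j (fun x : E₁ × E₂ => F (x.1, c • x.2, d)) (y, 0)
        (S.piecewise (fun i => (0, (v i).2)) fun i => ((v i).1, 0)) =
      (c : ℂ) ^ S.card * iteratedFDeriv ℝ j F (y, 0, d)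
        (S.piecewise (fun i => (0, (v i).2, 0)) fun i => ((v i).1, 0, 0)) := by
  have hsm : ContDiffAt ℝ ∞ F (y, 0, d) :=
    hFs.contDiffAt ((isOpen_deformationDomain hU).mem_nhds (by simpa [deformationDomain] using hy))
  let A : (E₁ × E₂) →L[ℝ] (E₁ × E₂ × ℝ) :=
    (ContinuousLinearMap.fst ℝ E₁ E₂).prod
      ((c • ContinuousLinearMap.snd ℝ E₁ E₂).prod 0)
  have hA : ∀ x, A x + (0, 0, d) = (x.1, c • x.2, d) := fun x => by simp [A]
  have h1 := iteratedFDeriv_comp_affine (f := F) A (0, 0, d) (x := (y, 0))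
    (by simpa [hA] using hsm) j
  simp only [hA, smul_zero] at h1
  have hAw : ∀ i, A (S.piecewise (fun i => (0, (v i).2)) (fun i => ((v i).1, 0)) i) =
      (if i ∈ S then c else 1) •
        (S.piecewise (fun i => ((0, (v i).2, 0) : E₁ × E₂ × ℝ)) fun i => ((v i).1, 0, 0)) i := by
    intro i
    by_cases hi : i ∈ S <;> simp [A, hi]
  rw [h1, ContinuousMultilinearMap.compContinuousLinearMap_apply]
  simp only [hAw, ContinuousMultilinearMap.map_smul_univ, Finset.prod_ite_mem, Finset.univ_inter,
    Finset.prod_const, Complex.real_smul]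
  push_cast
  rfl

theorem iteratedFDeriv_restrict_eq_zero (hU : IsOpen U)
    (hFs : ContDiffOn ℝ ∞ F (deformationDomain U))
    (hF : ∀ (s : ℝ), 0 < s → ∀ p : E₁ × E₂ × ℝ, F (p.1, s • p.2.1, s⁻¹ * p.2.2) = (s : ℂ) ^ a * F p)
    (hy : (y, 0) ∈ U) (ha : ∀ r ≤ j, ∀ n : ℕ, (r : ℂ) - a ≠ n) (c d : ℝ) :
    iteratedFDeriv ℝ j (fun x : E₁ × E₂ => F (x.1, c • x.2, d)) (y, 0) = 0 := by
  refine ContinuousMultilinearMap.eq_zero_of_prod _ fun S v => ?_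
  rw [iteratedFDeriv_restrict hU hFs hy,
    eq_zero_of_homogeneous (contDiff_iteratedFDeriv_apply hU hFs hy _)
      (iteratedFDeriv_homogeneous hU hFs hF hy S v)
      (ha _ (by simpa using S.card_le_univ)), mul_zero]

/-- The point `(y, ξ)` of the slice at `t = -1` has deformation coordinates `(y, -ξ, -1)`. The
resulting sign `(-1)^|S|`, the parity `(-1)^(|S| - z)` of the monomial and the prefactor `(-1)^z`
cancel. -/
theorem iteratedFDeriv_restrict_sub_eq_zero (hU : IsOpen U)
    (hFs : ContDiffOn ℝ ∞ F (deformationDomain U)) (z : ℤ)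
    (hF : ∀ (s : ℝ), 0 < s → ∀ p : E₁ × E₂ × ℝ,
      F (p.1, s • p.2.1, s⁻¹ * p.2.2) = (s : ℂ) ^ (z : ℂ) * F p)
    (hy : (y, 0) ∈ U) :
    iteratedFDeriv ℝ j (fun x : E₁ × E₂ => F (x.1, (1 : ℝ) • x.2, 1) -
      (-1 : ℂ) ^ z * F (x.1, (-1 : ℝ) • x.2, -1)) (y, 0) = 0 := by
  have hsm : ∀ c d : ℝ, c * c = 1 → d = c →
      ContDiffAt ℝ j (fun x : E₁ × E₂ => F (x.1, c • x.2, d)) (y, 0) := by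
    intro c d hc hd
    have h1 : ContDiffOn ℝ ∞ (fun x : E₁ × E₂ => F (x.1, c • x.2, d)) U :=
      hFs.comp (by fun_prop : ContDiff ℝ ∞ _).contDiffOn fun x hx => by
        simpa [deformationDomain, smul_smul, hd, hc] using hx
    exact (h1.contDiffAt (hU.mem_nhds hy)).of_le (by exact_mod_cast le_top)
  have e : (fun x : E₁ × E₂ => F (x.1, (1 : ℝ) • x.2, 1) -
      (-1 : ℂ) ^ z * F (x.1, (-1 : ℝ) • x.2, -1)) =
      (fun x : E₁ × E₂ => F (x.1, (1 : ℝ) • x.2, 1)) +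
        fun x : E₁ × E₂ => (-(-1 : ℂ) ^ z) • F (x.1, (-1 : ℝ) • x.2, -1) := by
    ext x; simp [sub_eq_add_neg]
  rw [e, iteratedFDeriv_add_apply (hsm 1 1 (by norm_num) rfl)
    (ContDiffAt.const_smul (R := ℂ) (-(-1 : ℂ) ^ z) (hsm (-1) (-1) (by norm_num) rfl)),
    iteratedFDeriv_const_smul_apply' (hsm (-1) (-1) (by norm_num) rfl)]
  refine ContinuousMultilinearMap.eq_zero_of_prod _ fun S v => ?_
  rw [add_apply, smul_apply,
    iteratedFDeriv_restrict hU hFs hy, iteratedFDeriv_restrict hU hFs hy]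
  have hu := contDiff_iteratedFDeriv_apply hU hFs hy
    (S.piecewise (fun i => (0, (v i).2, 0)) fun i => ((v i).1, 0, 0))
  have hh := iteratedFDeriv_homogeneous hU hFs hF hy S v
  by_cases hn : ∃ n : ℕ, (S.card : ℤ) - z = n
  · obtain ⟨n, hn⟩ := hn
    have hn' : (S.card : ℂ) - z = (n : ℂ) := by exact_mod_cast congrArg (Int.cast (R := ℂ)) hn
    rw [hn'] at hh
    have key := apply_neg_one_of_homogeneous hu hh
    have hz : (-1 : ℂ) ^ z * ((-1) ^ S.card * (-1) ^ n) = 1 := by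
      rw [← zpow_natCast (-1 : ℂ) n, ← hn, ← zpow_natCast (-1 : ℂ) S.card,
        ← zpow_add₀ (by simp), ← zpow_add₀ (by simp)]
      exact Even.neg_one_zpow ⟨S.card, by ring⟩
    simp only [key, Complex.ofReal_neg, Complex.ofReal_one, one_pow, one_mul, smul_eq_mul]
    linear_combination (-(iteratedFDeriv ℝ j F (y, 0, 1)
      (S.piecewise (fun i => (0, (v i).2, 0)) fun i => ((v i).1, 0, 0)))) * hz
  · have hn' : ∀ n : ℕ, (S.card : ℂ) - z ≠ n := fun n e => hn ⟨n, by exact_mod_cast e⟩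
    rw [eq_zero_of_homogeneous hu hh hn', eq_zero_of_homogeneous hu hh hn']
    simp

end Homogeneous

end Slice

/-! ### Adapted charts and computations in them. -/

namespace AdaptedChart

variable {m' m : ℕ} {V M : Type*}
  [TopologicalSpace V] [ChartedSpace (EuclideanSpace ℝ (Fin m')) V]
  [TopologicalSpace M] [ChartedSpace (EuclideanSpace ℝ (Fin m)) M]
  {ι : V → M}

-- The normal form of an immersion supplies the charts. Two shrinkings remain: `W` removes other
-- sheets of `V`, by the embedding property, and `s` keeps the slice of the target inside
-- `χ.target`.
open Manifold in
theorem exists_mem_source [IsManifold (𝓡 m') ∞ V] [IsManifold (𝓡 m) ∞ M]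
    (hι : IsSmoothEmbedding (𝓡 m') (𝓡 m) ∞ ι) (x : V) :
    ∃ c : AdaptedChart m' m ι, x ∈ c.χ.source := by
  have h := hι.isImmersion.isImmersionAt x
  let e := h.equiv
  have : FiniteDimensional ℝ (EuclideanSpace ℝ (Fin m') × h.complement) :=
    e.symm.toLinearEquiv.finiteDimensional
  have : FiniteDimensional ℝ h.complement :=
    FiniteDimensional.of_surjective (LinearMap.snd ℝ (EuclideanSpace ℝ (Fin m')) h.complement)
      LinearMap.snd_surjective
  have hdim : Module.finrank ℝ h.complement = m - m' := by
    have := e.toLinearEquiv.finrank_eq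
    simp only [Module.finrank_prod, finrank_euclideanSpace_fin] at this
    omega
  let e₂ : h.complement ≃L[ℝ] EuclideanSpace ℝ (Fin (m - m')) :=
    ContinuousLinearEquiv.ofFinrankEq (by simp [hdim])
  let L : EuclideanSpace ℝ (Fin m) ≃L[ℝ]
      EuclideanSpace ℝ (Fin m') × EuclideanSpace ℝ (Fin (m - m')) :=
    e.symm.trans ((ContinuousLinearEquiv.refl ℝ _).prodCongr e₂)
  set χ := h.domChart with hχ
  set φ := h.codChart with hφ
  have happ : ∀ z ∈ χ.source, L (φ (ι z)) = (χ z, 0) := by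
    intro z hz
    have h1 := h.writtenInCharts (show χ z ∈ (h.domChart.extend (𝓡 m')).target by
      simpa using χ.map_source hz)
    have h2 : φ (ι z) = h.equiv (χ z, 0) := by
      rw [← h.domChart.left_inv hz]
      simpa [hφ, hχ, h.domChart.left_inv hz] using h1
    simp [L, h2, e]
  obtain ⟨W, hW, hWχ⟩ := hι.isEmbedding.isOpen_iff.1 χ.open_source
  let s : Set M := φ.source ∩ φ ⁻¹' ((fun z => (L z).1) ⁻¹' χ.target)
  have hs : IsOpen s := φ.isOpen_inter_preimage (χ.open_target.preimage (by fun_prop))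
  have hsrc : (φ.restr (s ∩ W)).source = s ∩ W := by
    rw [OpenPartialHomeomorph.restr_source, (hs.inter hW).interior_eq]
    exact Set.inter_eq_right.2 fun z hz => hz.1.1
  refine ⟨⟨χ, φ.restr (s ∩ W), L, h.domChart_mem_maximalAtlas,
    restr_mem_maximalAtlas _ h.codChart_mem_maximalAtlas (hs.inter hW), ?_, ?_, ?_⟩,
    h.mem_domChart_source⟩
  · rw [hsrc]
    ext z
    constructor
    · intro hz
      refine ⟨⟨h.source_subset_preimage_source hz, ?_⟩, ?_⟩
      · simpa [happ z hz] using χ.map_source hz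
      · rw [← hWχ] at hz; exact hz
    · intro hz
      rw [← hWχ]; exact hz.2
  · exact happ
  · intro y hy
    have h1 := (φ.restr (s ∩ W)).map_target hy
    rw [hsrc] at h1
    have h2 : (L (φ ((φ.restr (s ∩ W)).symm (L.symm (y, 0))))).1 ∈ χ.target := h1.1.2
    have h3 : φ ((φ.restr (s ∩ W)).symm (L.symm (y, 0))) = L.symm (y, 0) :=
      (φ.restr (s ∩ W)).right_inv hy
    rw [h3, L.apply_symm_apply] at h2
    exact h2

/-- The target of the chart of `M`, in the coordinates `(y, ξ)`. -/
def splitTarget (c : AdaptedChart m' m ι) :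
    Set (EuclideanSpace ℝ (Fin m') × EuclideanSpace ℝ (Fin (m - m'))) :=
  c.L.symm ⁻¹' c.φ.target

/-- A function on `M` in the coordinates `(y, ξ)`. -/
def localRep (c : AdaptedChart m' m ι) (g : M → ℂ) :
    EuclideanSpace ℝ (Fin m') × EuclideanSpace ℝ (Fin (m - m')) → ℂ :=
  fun p => g (c.φ.symm (c.L.symm p))

theorem isOpen_splitTarget (c : AdaptedChart m' m ι) : IsOpen c.splitTarget :=
  c.φ.open_target.preimage c.L.symm.continuous

theorem domain_eq (c : AdaptedChart m' m ι) : c.domain = deformationDomain c.splitTarget := rfl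

theorem mem_phi_source (c : AdaptedChart m' m ι) {x : V} (hx : x ∈ c.χ.source) :
    ι x ∈ c.φ.source := by
  rw [c.source_eq] at hx; exact hx

theorem phi_apply (c : AdaptedChart m' m ι) {x : V} (hx : x ∈ c.χ.source) :
    c.φ (ι x) = c.L.symm (c.χ x, 0) := by
  rw [← c.apply_eq x hx, c.L.symm_apply_apply]

theorem mem_splitTarget (c : AdaptedChart m' m ι) {x : V} (hx : x ∈ c.χ.source) :
    (c.χ x, 0) ∈ c.splitTarget := by
  change c.L.symm (c.χ x, 0) ∈ c.φ.target
  rw [← c.phi_apply hx]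
  exact c.φ.map_source (c.mem_phi_source hx)

theorem phi_symm_slice (c : AdaptedChart m' m ι) {y : EuclideanSpace ℝ (Fin m')}
    (hy : (y, 0) ∈ c.splitTarget) : c.φ.symm (c.L.symm (y, 0)) = ι (c.χ.symm y) := by
  have hy' := c.mem_target y hy
  have h1 := c.phi_apply (c.χ.map_target hy')
  rw [c.χ.right_inv hy'] at h1
  rw [← h1, c.φ.left_inv (c.mem_phi_source (c.χ.map_target hy'))]

theorem contDiffOn_localRep [IsManifold (𝓡 m) ∞ M] (c : AdaptedChart m' m ι) {g : M → ℂ}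
    (hg : ContMDiff (𝓡 m) 𝓘(ℝ, ℂ) ∞ g) : ContDiffOn ℝ ∞ (c.localRep g) c.splitTarget := by
  have h1 : ContDiffOn ℝ ∞ (g ∘ c.φ.symm) c.φ.target :=
    (hg.comp_contMDiffOn (contMDiffOn_symm_of_mem_maximalAtlas c.φ_mem)).contDiffOn
  exact h1.comp c.L.symm.contDiff.contDiffOn fun _ h => h

theorem contDiffAt_chart_symm [IsManifold (𝓡 m) ∞ M] {g : M → ℂ}
    (hg : ContMDiff (𝓡 m) 𝓘(ℝ, ℂ) ∞ g) {φ : OpenPartialHomeomorph M (EuclideanSpace ℝ (Fin m))}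
    (hφ : φ ∈ IsManifold.maximalAtlas (𝓡 m) ∞ M) {p : M} (hp : p ∈ φ.source) :
    ContDiffAt ℝ ∞ (g ∘ φ.symm) (φ p) :=
  (hg.comp_contMDiffOn (contMDiffOn_symm_of_mem_maximalAtlas hφ)).contDiffOn.contDiffAt
    (φ.open_target.mem_nhds (φ.map_source hp))

theorem iteratedFDeriv_localRep_eq_zero [IsManifold (𝓡 m) ∞ M] (c : AdaptedChart m' m ι)
    {g : M → ℂ} (hg : ContMDiff (𝓡 m) 𝓘(ℝ, ℂ) ∞ g) {k : ℕ}
    (h : VanishesToOrderOn m k g (Set.range ι)) {y : EuclideanSpace ℝ (Fin m')}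
    (hy : (y, 0) ∈ c.splitTarget) {j : ℕ} (hj : j ≤ k) :
    iteratedFDeriv ℝ j (c.localRep g) (y, 0) = 0 := by
  have hx := c.χ.map_target (c.mem_target y hy)
  have e : c.L.symm (y, 0) = c.φ (ι (c.χ.symm y)) := by
    rw [c.phi_apply hx, c.χ.right_inv (c.mem_target y hy)]
  refine iteratedFDeriv_comp_eq_zero (g := g ∘ c.φ.symm) (h := c.L.symm) ?_
    c.L.symm.contDiff.contDiffAt fun i hi => ?_
  · rw [e]; exact contDiffAt_chart_symm hg c.φ_mem (c.mem_phi_source hx)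
  · rw [e]; exact h _ ⟨_, rfl⟩ _ c.φ_mem (c.mem_phi_source hx) i (hi.trans hj)

/-- One adapted chart at each point suffices, since vanishing to order `k` survives the change of
charts. -/
theorem vanishesToOrderOn_of_localRep [IsManifold (𝓡 m) ∞ M] {g : M → ℂ}
    (hg : ContMDiff (𝓡 m) 𝓘(ℝ, ℂ) ∞ g) {k : ℕ}
    (h : ∀ x : V, ∃ c : AdaptedChart m' m ι, x ∈ c.χ.source ∧
      ∀ j ≤ k, iteratedFDeriv ℝ j (c.localRep g) (c.χ x, 0) = 0) :
    VanishesToOrderOn m k g (Set.range ι) := by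
  rintro _ ⟨x, rfl⟩ ψ hψ hxψ j hj
  obtain ⟨c, hx, hc⟩ := h x
  have hxφ := c.mem_phi_source hx
  have hsymm : ContinuousAt ψ.symm (ψ (ι x)) := ψ.continuousAt_symm (ψ.map_source hxψ)
  have hnear : ∀ᶠ z in nhds (ψ (ι x)), ψ.symm z ∈ c.φ.source :=
    hsymm.eventually_mem (by rw [ψ.left_inv hxψ]; exact c.φ.open_source.mem_nhds hxφ)
  have heq : g ∘ ψ.symm =ᶠ[nhds (ψ (ι x))] c.localRep g ∘ fun z => c.L (c.φ (ψ.symm z)) := by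
    filter_upwards [hnear] with z hz
    simp [localRep, c.φ.left_inv hz]
  have e : c.L (c.φ (ψ.symm (ψ (ι x)))) = (c.χ x, 0) := by
    rw [ψ.left_inv hxψ, c.apply_eq x hx]
  rw [(heq.iteratedFDeriv ℝ j).eq_of_nhds]
  refine iteratedFDeriv_comp_eq_zero ?_ ?_ fun i hi => ?_
  · rw [e]
    exact (c.contDiffOn_localRep hg).contDiffAt (c.isOpen_splitTarget.mem_nhds (c.mem_splitTarget hx))
  · have h1 : ContMDiffAt (𝓡 m) (𝓡 m) ∞ (c.φ ∘ ψ.symm) (ψ (ι x)) :=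
      ContMDiffAt.comp (I' := 𝓡 m) _
        ((contMDiffOn_of_mem_maximalAtlas c.φ_mem).contMDiffAt
          (by rw [ψ.left_inv hxψ]; exact c.φ.open_source.mem_nhds hxφ))
        ((contMDiffOn_symm_of_mem_maximalAtlas hψ).contMDiffAt
          (ψ.open_target.mem_nhds (ψ.map_source hxψ)))
    exact c.L.contDiff.contDiffAt.comp _ h1.contDiffAt
  · rw [e]; exact hc i (hi.trans hj)

/-- The differential of the chart of `M` at `p`, in the preferred coordinates of `T_p M`. -/
noncomputable def chartDeriv (c : AdaptedChart m' m ι) (p : M) :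
    EuclideanSpace ℝ (Fin m) →L[ℝ] EuclideanSpace ℝ (Fin m) :=
  mfderiv (𝓡 m) 𝓘(ℝ, EuclideanSpace ℝ (Fin m)) c.φ p

/-- The class in the normal space at `x` of the tangent vector with preferred coordinates `v`. -/
noncomputable def normalClass (ι : V → M) (x : V) (v : EuclideanSpace ℝ (Fin m)) : NormalFiber m' m ι x :=
  Submodule.Quotient.mk (show TangentSpace (𝓡 m) (ι x) from v)

theorem hasFDerivAt_chart [IsManifold (𝓡 m) ∞ M] (c : AdaptedChart m' m ι) {p : M}
    (hp : p ∈ c.φ.source) :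
    HasFDerivAt (c.φ ∘ (extChartAt (𝓡 m) p).symm)
      (c.chartDeriv p) (extChartAt (𝓡 m) p p) := by
  have h1 : MDifferentiableAt (𝓡 m) 𝓘(ℝ, EuclideanSpace ℝ (Fin m)) c.φ p :=
    ((contMDiffOn_of_mem_maximalAtlas c.φ_mem).contMDiffAt
      (c.φ.open_source.mem_nhds hp)).mdifferentiableAt (by simp)
  have h2 : HasFDerivWithinAt (c.φ ∘ (extChartAt (𝓡 m) p).symm)
      (c.chartDeriv p) (Set.range (𝓡 m))
      (extChartAt (𝓡 m) p p) := h1.hasMFDerivAt.2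
  rwa [ModelWithCorners.range_eq_univ, hasFDerivWithinAt_univ] at h2

theorem isInvertible_chartDeriv [IsManifold (𝓡 m) ∞ M] (c : AdaptedChart m' m ι) {p : M}
    (hp : p ∈ c.φ.source) :
    (c.chartDeriv p).IsInvertible := by
  have hc : OpenPartialHomeomorph.MDifferentiable (𝓡 m) 𝓘(ℝ, EuclideanSpace ℝ (Fin m)) c.φ :=
    ⟨(contMDiffOn_of_mem_maximalAtlas c.φ_mem).mdifferentiableOn (by simp),
      (contMDiffOn_symm_of_mem_maximalAtlas c.φ_mem).mdifferentiableOn (by simp)⟩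
  exact ⟨hc.mfderiv hp, rfl⟩


open Set Filter Topology in
/-- The value on the normal bundle of an extension of `t⁻ᵏ g`, for `g` vanishing to order `k - 1`
on the submanifold. -/
theorem apply_normal_eq_dirDeriv [IsManifold (𝓡 m) ∞ M] (c : AdaptedChart m' m ι) {x : V}
    (hx : x ∈ c.χ.source) {g : M → ℂ} (hg : ContMDiff (𝓡 m) 𝓘(ℝ, ℂ) ∞ g) (k : ℕ)
    (hv : ∀ j < k, VanishesToOrderOn m j g (range ι))
    {G : EuclideanSpace ℝ (Fin m') × EuclideanSpace ℝ (Fin (m - m')) × ℝ → ℂ}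
    {ξ : EuclideanSpace ℝ (Fin (m - m'))} (hG : ContinuousAt G (c.χ x, ξ, 0))
    (hGg : ∀ p ∈ c.domain, 0 < p.2.2 →
      c.localRep g (p.1, p.2.2 • p.2.1) = (p.2.2 : ℂ) ^ k * G p)
    (v : EuclideanSpace ℝ (Fin m))
    (hξ : (c.L (c.chartDeriv (ι x) v)).2 = ξ) :
    G (c.χ x, ξ, 0) = 1 / (k.factorial : ℂ) * dirDeriv m k g (ι x) v := by
  set e := extChartAt (𝓡 m) (ι x) with he
  have hchart : chartAt (EuclideanSpace ℝ (Fin m)) (ι x) ∈ IsManifold.maximalAtlas (𝓡 m) ∞ M :=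
    IsManifold.chart_mem_maximalAtlas (ι x)
  have hsm : ContDiffAt ℝ ∞ (g ∘ e.symm) (e (ι x)) :=
    contDiffAt_chart_symm hg hchart (mem_chart_source _ _)
  have hφx := c.mem_phi_source hx
  have hline : ContDiff ℝ ∞ fun t : ℝ => t • v + e (ι x) := by fun_prop
  have hl0 : (0 : ℝ) • v + e (ι x) = e (ι x) := by simp
  have h1 := tendsto_div_pow_of_iteratedDeriv_eq_zero (h := fun t : ℝ => (g ∘ e.symm) (t • v + e (ι x)))
    (ContDiffAt.comp (g := g ∘ e.symm) (0 : ℝ) (by rwa [hl0]) hline.contDiffAt) k fun j hj => by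
      rw [iteratedDeriv_comp_line v hsm]
      have := hv j hj (ι x) ⟨x, rfl⟩ _ hchart (mem_chart_source _ _) j le_rfl
      exact congrArg (fun T => T fun _ => v) this
  rw [iteratedDeriv_comp_line v hsm] at h1
  -- The straight line with velocity `v` in the preferred chart, seen in adapted coordinates.
  -- Dividing its normal part by `t` gives a curve in the deformation space that tends to `(χ x, ξ,
  -- 0)`, along which `G` equals `t^{-k} g`.
  set γ : ℝ → EuclideanSpace ℝ (Fin m') × EuclideanSpace ℝ (Fin (m - m')) :=
    fun t => c.L (c.φ (e.symm (t • v + e (ι x)))) with hγ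
  have hγ0 : γ 0 = (c.χ x, 0) := by
    simp only [hγ, hl0]
    rw [extChartAt_to_inv, c.apply_eq x hx]
  have hγd : HasDerivAt γ
      (c.L (c.chartDeriv (ι x) v)) 0 := by
    have d1 : HasDerivAt (fun t : ℝ => t • v + e (ι x)) v 0 := by
      simpa using ((hasDerivAt_id (0 : ℝ)).smul_const v).add_const (e (ι x))
    have d2 := c.hasFDerivAt_chart hφx
    rw [← he, show e (ι x) = (0 : ℝ) • v + e (ι x) from hl0.symm] at d2
    exact (c.L.hasFDerivAt (x := (c.φ ∘ e.symm) ((0 : ℝ) • v + e (ι x)))).comp_hasDerivAt (0 : ℝ)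
      (HasFDerivAt.comp_hasDerivAt (l := c.φ ∘ e.symm) (0 : ℝ) d2 d1)
  have hslope : Tendsto (fun t : ℝ => t⁻¹ • (γ t).2) (𝓝[>] 0) (𝓝 ξ) := by
    have d3 : HasDerivAt (fun t => (γ t).2) ξ 0 := by
      rw [← hξ]; exact hasFDerivAt_snd.comp_hasDerivAt (0 : ℝ) hγd
    have := d3.tendsto_slope_zero_right
    simpa [hγ0] using this
  have hγc : Tendsto γ (𝓝[>] 0) (𝓝 (c.χ x, 0)) := by
    rw [← hγ0]; exact hγd.continuousAt.tendsto.mono_left nhdsWithin_le_nhds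
  have hGt : Tendsto (fun t : ℝ => G ((γ t).1, t⁻¹ • (γ t).2, t)) (𝓝[>] 0)
      (𝓝 (G (c.χ x, ξ, 0))) :=
    hG.tendsto.comp ((continuous_fst.continuousAt.tendsto.comp hγc).prodMk_nhds
      (hslope.prodMk_nhds (tendsto_id.mono_left nhdsWithin_le_nhds)))
  have hsrc : ∀ᶠ t : ℝ in 𝓝 0, e.symm (t • v + e (ι x)) ∈ c.φ.source := by
    have : ContinuousAt (fun t : ℝ => e.symm (t • v + e (ι x))) 0 :=
      ContinuousAt.comp (by rw [hl0]; exact continuousAt_extChartAt_symm (ι x))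
        hline.continuous.continuousAt
    refine this.eventually_mem (c.φ.open_source.mem_nhds ?_)
    rw [hl0, extChartAt_to_inv]
    exact hφx
  refine tendsto_nhds_unique hGt
    ((h1.mono_left (nhdsWithin_mono _ fun t ht => (show (0 : ℝ) < t from ht).ne')).congr' ?_)
  filter_upwards [self_mem_nhdsWithin, hsrc.filter_mono nhdsWithin_le_nhds] with t ht hts
  have ht0 : t ≠ 0 := (show 0 < t from ht).ne'
  have htk : (t : ℂ) ^ k ≠ 0 := pow_ne_zero _ (by exact_mod_cast ht0)
  have hback : (((γ t).1, t • t⁻¹ • (γ t).2) :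
      EuclideanSpace ℝ (Fin m') × EuclideanSpace ℝ (Fin (m - m'))) = γ t := by
    rw [smul_inv_smul₀ ht0]
  have hrep : c.localRep g (γ t) = (g ∘ e.symm) (t • v + e (ι x)) := by
    simp [localRep, hγ, c.φ.left_inv hts]
  have := hGg ((γ t).1, t⁻¹ • (γ t).2, t) (by
    change c.L.symm ((γ t).1, t • t⁻¹ • (γ t).2) ∈ c.φ.target
    rw [hback]
    simpa [hγ] using c.φ.map_source hts) ht
  simp only [hback] at this
  rw [← hrep, this, inv_mul_cancel_left₀ htk]

theorem param_of_ne_zero (c : AdaptedChart m' m ι)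
    (p : EuclideanSpace ℝ (Fin m') × EuclideanSpace ℝ (Fin (m - m')) × ℝ) (h : p.2.2 ≠ 0) :
    c.param p = DNC.generic (c.φ.symm (c.L.symm (p.1, p.2.2 • p.2.1))) (Units.mk0 p.2.2 h) :=
  dif_neg h

theorem param_zero (c : AdaptedChart m' m ι)
    (y : EuclideanSpace ℝ (Fin m')) (ξ : EuclideanSpace ℝ (Fin (m - m'))) :
    c.param (y, ξ, 0) = DNC.normal (c.χ.symm y)
      (normalClass ι _ ((c.chartDeriv (ι (c.χ.symm y))).inverse (c.L.symm (0, ξ)))) :=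
  dif_pos rfl

theorem zoom_param (c : AdaptedChart m' m ι) (s : ℝ) (hs : 0 < s)
    (p : EuclideanSpace ℝ (Fin m') × EuclideanSpace ℝ (Fin (m - m')) × ℝ) :
    DNC.zoom s hs (c.param p) = c.param (p.1, s • p.2.1, s⁻¹ * p.2.2) := by
  obtain ⟨y, ξ, t⟩ := p
  by_cases ht : t = 0
  · subst ht
    simp only [mul_zero, param_zero, DNC.zoom]
    congr 1
    have : ((0, s • ξ) : EuclideanSpace ℝ (Fin m') × EuclideanSpace ℝ (Fin (m - m'))) =
        s • (0, ξ) := by simp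
    rw [this, map_smul, map_smul]
    rfl
  · have ht' : s⁻¹ * t ≠ 0 := mul_ne_zero (inv_ne_zero hs.ne') ht
    rw [param_of_ne_zero _ _ ht, param_of_ne_zero _ _ ht']
    simp only [DNC.zoom]
    congr 1
    · have : (s⁻¹ * t) • s • ξ = t • ξ := by
        rw [smul_smul]; congr 1; field_simp
      rw [this]
    · ext; simp

/-- Discarding the tangential coordinate of `v` changes it by a vector tangent to `V`, by the chain
rule for `φ ∘ ι = L⁻¹ (χ, 0)`. -/
theorem normalClass_inverse_eq [IsManifold (𝓡 m') ∞ V] [IsManifold (𝓡 m) ∞ M]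
    (c : AdaptedChart m' m ι) (hι : ContMDiff (𝓡 m') (𝓡 m) ∞ ι) {x : V} (hx : x ∈ c.χ.source)
    (v : EuclideanSpace ℝ (Fin m)) :
    normalClass ι x ((c.chartDeriv (ι x)).inverse
      (c.L.symm (0, (c.L (c.chartDeriv (ι x) v)).2))) =
      normalClass (m' := m') ι x v := by
  have hφx := c.mem_phi_source hx
  have hinv := c.isInvertible_chartDeriv hφx
  have hχ : OpenPartialHomeomorph.MDifferentiable (𝓡 m') 𝓘(ℝ, EuclideanSpace ℝ (Fin m')) c.χ :=
    ⟨(contMDiffOn_of_mem_maximalAtlas c.χ_mem).mdifferentiableOn (by simp),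
      (contMDiffOn_symm_of_mem_maximalAtlas c.χ_mem).mdifferentiableOn (by simp)⟩
  have hφd : MDifferentiableAt (𝓡 m) 𝓘(ℝ, EuclideanSpace ℝ (Fin m)) c.φ (ι x) :=
    ((contMDiffOn_of_mem_maximalAtlas c.φ_mem).contMDiffAt
      (c.φ.open_source.mem_nhds hφx)).mdifferentiableAt (by simp)
  let A : EuclideanSpace ℝ (Fin m') →L[ℝ] EuclideanSpace ℝ (Fin m) :=
    c.L.symm.toContinuousLinearMap.comp (ContinuousLinearMap.inl ℝ _ _)
  have e1 := mfderiv_comp x hφd (hι.mdifferentiable (by simp) x)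
  have e2 := mfderiv_comp (I'' := 𝓘(ℝ, EuclideanSpace ℝ (Fin m))) x
    (A.mdifferentiableAt (x := c.χ x)) (hχ.mdifferentiableAt hx)
  have e3 : c.φ ∘ ι =ᶠ[nhds x] A ∘ c.χ := by
    filter_upwards [c.χ.open_source.mem_nhds hx] with z hz
    exact c.phi_apply hz
  rw [e3.mfderiv_eq, e2, A.mfderiv_eq] at e1
  obtain ⟨u, hu⟩ := hχ.mfderiv_surjective hx (-(c.L (c.chartDeriv (ι x) v)).1)
  have e4 : A (mfderiv (𝓡 m') 𝓘(ℝ, EuclideanSpace ℝ (Fin m')) c.χ x u) =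
      c.chartDeriv (ι x) (mfderiv (𝓡 m') (𝓡 m) ι x u) := congrArg (fun T => T u) e1
  rw [hu] at e4
  refine (Submodule.Quotient.eq _).2 ⟨u, ?_⟩
  obtain ⟨D, hD⟩ := hinv
  change mfderiv (𝓡 m') (𝓡 m) ι x u = (c.chartDeriv (ι x)).inverse
      (c.L.symm (0, (c.L (c.chartDeriv (ι x) v)).2)) - v
  have hDe : ∀ w, c.chartDeriv (ι x) w = D w := fun w => by rw [← hD]; rfl
  rw [show (c.chartDeriv (ι x)).inverse = D.symm by
    rw [← hD, ContinuousLinearMap.inverse_equiv]]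
  rw [hDe] at e4 ⊢
  refine D.injective ((hDe _).symm.trans (e4.symm.trans (c.L.injective ?_)))
  rw [map_sub, ContinuousLinearEquiv.coe_coe, D.apply_symm_apply, map_sub, c.L.apply_symm_apply]
  ext <;> simp [A]

theorem param_chart_apply [IsManifold (𝓡 m') ∞ V] [IsManifold (𝓡 m) ∞ M] (c : AdaptedChart m' m ι)
    (hι : ContMDiff (𝓡 m') (𝓡 m) ∞ ι) {x : V} (hx : x ∈ c.χ.source)
    (v : EuclideanSpace ℝ (Fin m)) :
    c.param (c.χ x, (c.L (c.chartDeriv (ι x) v)).2, 0) = DNC.normal x (normalClass ι x v) := by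
  rw [param_zero, ← c.normalClass_inverse_eq hι hx v]
  generalize (c.L _).2 = ξ
  rw [c.χ.left_inv hx]

end AdaptedChart

/-! ### Scaling rules, and smoothness over `M × ℝ^*`. -/

theorem tPlus_mul (b : ℂ) {s : ℝ} (hs : 0 < s) (t : ℝ) :
    tPlus b (s * t) = (s : ℂ) ^ b * tPlus b t := by
  unfold tPlus
  simp only [mul_pos_iff_of_pos_left hs]
  split_ifs with h
  · rw [Complex.ofReal_mul, Complex.mul_cpow_ofReal_nonneg hs.le h.le]
  · simp

theorem tMinus_mul (b : ℂ) {s : ℝ} (hs : 0 < s) (t : ℝ) :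
    tMinus b (s * t) = (s : ℂ) ^ b * tMinus b t := by
  unfold tMinus
  rw [← mul_neg, tPlus_mul b hs]

theorem tMinus_of_nonneg (b : ℂ) {t : ℝ} (ht : 0 ≤ t) : tMinus b t = 0 :=
  tPlus_of_nonpos b (by linarith)

theorem tPlus_add_tMinus_intCast (z : ℤ) {t : ℝ} (ht : t ≠ 0) :
    tPlus z t + (-1 : ℂ) ^ z * tMinus z t = (t : ℂ) ^ z := by
  rcases ht.lt_or_gt with h | h
  · rw [tPlus_of_nonpos _ h.le, tMinus, tPlus_of_pos _ (neg_pos.2 h), Complex.cpow_intCast,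
      ← mul_zpow]
    simp
  · rw [tMinus_of_nonneg _ h.le, tPlus_of_pos _ h, Complex.cpow_intCast]
    simp

theorem ofReal_inv_cpow {s : ℝ} (hs : 0 < s) (a : ℂ) : ((s⁻¹ : ℝ) : ℂ) ^ (-a) = (s : ℂ) ^ a := by
  rw [Complex.ofReal_inv, Complex.inv_cpow _ _
    (by rw [Complex.arg_ofReal_of_nonneg hs.le]; exact Real.pi_pos.ne), Complex.cpow_neg, inv_inv]

section Manifold

variable {m' m : ℕ} {V M : Type*}
  [TopologicalSpace V] [ChartedSpace (EuclideanSpace ℝ (Fin m')) V]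
  [TopologicalSpace M] [ChartedSpace (EuclideanSpace ℝ (Fin m)) M]
  {ι : V → M}

theorem ContMDiff.complex_mul {E H N : Type*} [NormedAddCommGroup E] [NormedSpace ℝ E]
    [TopologicalSpace H] {I : ModelWithCorners ℝ E H} [TopologicalSpace N] [ChartedSpace H N]
    {g h : N → ℂ} (hg : ContMDiff I 𝓘(ℝ, ℂ) ∞ g) (hh : ContMDiff I 𝓘(ℝ, ℂ) ∞ h) :
    ContMDiff I 𝓘(ℝ, ℂ) ∞ fun x => g x * h x :=
  (contDiff_mul (𝕜 := ℝ) (𝔸 := ℂ) (n := ∞)).contMDiff.comp (hg.prodMk_space hh)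

theorem contMDiff_tPlus_units (b : ℂ) :
    ContMDiff 𝓘(ℝ, ℝ) 𝓘(ℝ, ℂ) ∞ fun t : ℝˣ => tPlus b t := fun t =>
  (contDiffAt_tPlus b t.ne_zero).contMDiffAt.comp t (Units.contMDiff_val t)

theorem contMDiff_tMinus_units (b : ℂ) :
    ContMDiff 𝓘(ℝ, ℝ) 𝓘(ℝ, ℂ) ∞ fun t : ℝˣ => tMinus b t := fun t =>
  ((contDiffAt_tPlus b (neg_ne_zero.2 t.ne_zero)).comp (t : ℝ)
    contDiffAt_id.neg).contMDiffAt.comp t (Units.contMDiff_val t)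

theorem contMDiff_mul_tMinus_add_mul_tPlus {gm gp : M → ℂ} (hm : ContMDiff (𝓡 m) 𝓘(ℝ, ℂ) ∞ gm)
    (hp : ContMDiff (𝓡 m) 𝓘(ℝ, ℂ) ∞ gp) (b : ℂ) :
    ContMDiff ((𝓡 m).prod 𝓘(ℝ, ℝ)) 𝓘(ℝ, ℂ) ∞
      fun p : M × ℝˣ => gm p.1 * tMinus b p.2 + gp p.1 * tPlus b p.2 :=
  ((hm.comp contMDiff_fst).complex_mul ((contMDiff_tMinus_units b).comp contMDiff_snd)).add
    ((hp.comp contMDiff_fst).complex_mul ((contMDiff_tPlus_units b).comp contMDiff_snd))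

theorem VanishesToOrderOn.const_mul [IsManifold (𝓡 m) ∞ M] {g : M → ℂ} {k : ℕ} {S : Set M}
    (hg : ContMDiff (𝓡 m) 𝓘(ℝ, ℂ) ∞ g) (h : VanishesToOrderOn m k g S) (ε : ℂ) :
    VanishesToOrderOn m k (fun x => ε * g x) S := fun p hp φ hφ hpφ j hj => by
  have h1 := AdaptedChart.contDiffAt_chart_symm hg hφ hpφ
  have := iteratedFDeriv_const_smul_apply (𝕜 := ℝ) (a := ε)
    (h1.of_le (m := j) (by exact_mod_cast le_top))
  rw [h p hp φ hφ hpφ j hj, smul_zero] at this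
  exact this

theorem VanishesToOrderOn.mono {g : M → ℂ} {k l : ℕ} {S : Set M}
    (h : VanishesToOrderOn m k g S) (hl : l ≤ k) : VanishesToOrderOn m l g S :=
  fun p hp φ hφ hpφ j hj => h p hp φ hφ hpφ j (hj.trans hl)

/-- Functions on the extended chart domain that agree for positive parameters agree at `0`. -/
theorem eq_at_zero_of_eq_of_pos (c : AdaptedChart m' m ι)
    {F Q : EuclideanSpace ℝ (Fin m') × EuclideanSpace ℝ (Fin (m - m')) × ℝ → ℂ}
    (hF : ContDiffOn ℝ ∞ F c.domain) (hQ : ContDiffOn ℝ ∞ Q c.domain)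
    (h : ∀ p ∈ c.domain, 0 < p.2.2 → F p = Q p) {y : EuclideanSpace ℝ (Fin m')}
    (hy : (y, 0) ∈ c.splitTarget) (ξ : EuclideanSpace ℝ (Fin (m - m'))) :
    F (y, ξ, 0) = Q (y, ξ, 0) := by
  have hΩ : IsOpen c.domain := isOpen_deformationDomain c.isOpen_splitTarget
  have hmem : ((y, ξ, 0) : EuclideanSpace ℝ (Fin m') × EuclideanSpace ℝ (Fin (m - m')) × ℝ) ∈
      c.domain := by
    simpa [AdaptedChart.domain_eq, deformationDomain] using hy
  have hl : Continuous fun t : ℝ => (y, ξ, t) := by fun_prop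
  have hlim : ∀ {G : EuclideanSpace ℝ (Fin m') × EuclideanSpace ℝ (Fin (m - m')) × ℝ → ℂ},
      ContDiffOn ℝ ∞ G c.domain → Filter.Tendsto (fun t : ℝ => G (y, ξ, t))
      (nhdsWithin 0 (Set.Ioi 0)) (nhds (G (y, ξ, 0))) := fun {G} hG =>
    ((hG.contDiffAt (hΩ.mem_nhds hmem)).continuousAt.tendsto.comp (hl.tendsto 0)).mono_left
      nhdsWithin_le_nhds
  refine tendsto_nhds_unique (hlim hF) ((hlim hQ).congr' ?_)
  filter_upwards [self_mem_nhdsWithin, (hl.continuousAt.eventually_mem (x := (0 : ℝ))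
    (hΩ.mem_nhds hmem)).filter_mono nhdsWithin_le_nhds] with t ht htΩ
  exact (h _ htΩ ht).symm

/-! ### Slices of homogeneous functions, and the converse gluing. -/

namespace DNC

variable {f : DNC m' m ι → ℂ} {a : ℂ}

section Forward

theorem IsSmooth.contMDiff_slice (hf : IsSmooth f) (u : ℝˣ) :
    ContMDiff (𝓡 m) 𝓘(ℝ, ℂ) ∞ fun x => f (generic x u) :=
  hf.1.comp (contMDiff_id.prodMk contMDiff_const)

theorem IsHomogeneous.generic_eq (h : IsHomogeneous a f) (x : M) (t : ℝˣ) :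
    f (generic x t) =
      f (generic x (-1)) * tMinus (-a) t + f (generic x 1) * tPlus (-a) t := by
  rcases t.ne_zero.lt_or_gt with ht | ht
  · have ht' : 0 < -(t : ℝ) := neg_pos.2 ht
    -- The zoom divides the parameter by `s`, so `s = |t|⁻¹` carries `-1` to `t`.
    have h1 := h (-(t : ℝ))⁻¹ (inv_pos.2 ht') (generic x (-1))
    have e : (Units.mk0 (-(t : ℝ))⁻¹ (inv_pos.2 ht').ne')⁻¹ * -1 = t := by ext; simp
    rw [zoom, e] at h1
    have h2 := ofReal_inv_cpow (inv_pos.2 ht') a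
    rw [inv_inv] at h2
    rw [h1, tPlus_of_nonpos _ ht.le, tMinus, tPlus_of_pos _ ht', h2]
    ring
  · have h1 := h (t : ℝ)⁻¹ (inv_pos.2 ht) (generic x 1)
    have e : (Units.mk0 (t : ℝ)⁻¹ (inv_pos.2 ht).ne')⁻¹ * 1 = t := by ext; simp
    rw [zoom, e] at h1
    have h2 := ofReal_inv_cpow (inv_pos.2 ht) a
    rw [inv_inv] at h2
    rw [h1, tPlus_of_pos _ ht, tMinus_of_nonneg _ ht.le, h2]
    ring

theorem IsHomogeneous.param (h : IsHomogeneous a f) (c : AdaptedChart m' m ι) (s : ℝ) (hs : 0 < s)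
    (p : EuclideanSpace ℝ (Fin m') × EuclideanSpace ℝ (Fin (m - m')) × ℝ) :
    f (c.param (p.1, s • p.2.1, s⁻¹ * p.2.2)) = (s : ℂ) ^ a * f (c.param p) := by
  rw [← c.zoom_param s hs]; exact h s hs _

theorem localRep_slice (f : DNC m' m ι → ℂ) (c : AdaptedChart m' m ι) {d : ℝ} (hd : d * d = 1)
    (u : ℝˣ) (hu : (u : ℝ) = d)
    (z : EuclideanSpace ℝ (Fin m') × EuclideanSpace ℝ (Fin (m - m'))) :
    c.localRep (fun x => f (generic x u)) z = f (c.param (z.1, d • z.2, d)) := by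
  have hd0 : d ≠ 0 := by rintro rfl; simp at hd
  rw [c.param_of_ne_zero _ hd0]
  have e : u = Units.mk0 d hd0 := by ext; simpa using hu
  simp [AdaptedChart.localRep, smul_smul, hd, e]

theorem localRep_pos (h : IsHomogeneous a f) (c : AdaptedChart m' m ι)
    (p : EuclideanSpace ℝ (Fin m') × EuclideanSpace ℝ (Fin (m - m')) × ℝ) (hp : 0 < p.2.2) :
    f (c.param p) = tPlus (-a) p.2.2 *
      c.localRep (fun x => f (generic x 1)) (p.1, p.2.2 • p.2.1) := by
  rw [c.param_of_ne_zero p hp.ne', h.generic_eq, Units.val_mk0, tMinus_of_nonneg _ hp.le,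
    AdaptedChart.localRep]
  ring

variable [IsManifold (𝓡 m') ∞ V] [IsManifold (𝓡 m) ∞ M]

theorem vanishesToOrderOn_slice (hι : Manifold.IsSmoothEmbedding (𝓡 m') (𝓡 m) ∞ ι)
    (hf : IsSmooth f) (h : IsHomogeneous a f) {k : ℕ} (ha : ∀ r ≤ k, ∀ n : ℕ, (r : ℂ) - a ≠ n)
    {d : ℝ} (hd : d * d = 1) (u : ℝˣ) (hu : (u : ℝ) = d) :
    VanishesToOrderOn m k (fun x => f (generic x u)) (Set.range ι) := by
  refine AdaptedChart.vanishesToOrderOn_of_localRep (m' := m') (hf.contMDiff_slice u) fun x => ?_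
  obtain ⟨c, hc⟩ := AdaptedChart.exists_mem_source hι x
  refine ⟨c, hc, fun j hj => ?_⟩
  rw [funext (localRep_slice f c hd u hu)]
  exact iteratedFDeriv_restrict_eq_zero (F := fun p => f (c.param p)) c.isOpen_splitTarget (hf.2 c)
    (h.param c) (c.mem_splitTarget hc) (fun r hr => ha r (hr.trans hj)) d d

theorem isFlatOn_slice_sub (hι : Manifold.IsSmoothEmbedding (𝓡 m') (𝓡 m) ∞ ι)
    (hf : IsSmooth f) {z : ℤ} (h : IsHomogeneous (z : ℂ) f) :
    IsFlatOn m ((fun x => f (generic x 1)) - fun x => (-1 : ℂ) ^ z * f (generic x (-1)))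
      (Set.range ι) := by
  intro k
  refine AdaptedChart.vanishesToOrderOn_of_localRep (m' := m')
    ((hf.contMDiff_slice 1).sub (contMDiff_const.complex_mul (hf.contMDiff_slice (-1))))
    fun x => ?_
  obtain ⟨c, hc⟩ := AdaptedChart.exists_mem_source hι x
  refine ⟨c, hc, fun j _ => ?_⟩
  have e : (c.localRep fun x => f (generic x 1) - (-1 : ℂ) ^ z * f (generic x (-1))) =
      fun p => f (c.param (p.1, (1 : ℝ) • p.2, 1)) -
        (-1 : ℂ) ^ z * f (c.param (p.1, (-1 : ℝ) • p.2, -1)) := by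
    ext p
    rw [← localRep_slice f c (by norm_num) 1 (by simp) p,
      ← localRep_slice f c (by norm_num) (-1) (by simp) p]
    rfl
  rw [e]
  exact iteratedFDeriv_restrict_sub_eq_zero (F := fun p => f (c.param p)) c.isOpen_splitTarget
    (hf.2 c) z (h.param c) (c.mem_splitTarget hc)

theorem exists_chart_normal (hι : Manifold.IsSmoothEmbedding (𝓡 m') (𝓡 m) ∞ ι) (x : V)
    (v : EuclideanSpace ℝ (Fin m)) :
    ∃ c : AdaptedChart m' m ι, x ∈ c.χ.source ∧
      c.param (c.χ x, (c.L (c.chartDeriv (ι x) v)).2, 0) =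
        normal x (AdaptedChart.normalClass ι x v) := by
  obtain ⟨c, hc⟩ := AdaptedChart.exists_mem_source hι x
  exact ⟨c, hc, c.param_chart_apply hι.contMDiff hc v⟩

end Forward

section Backward

theorem generic_zoom_eq {gm gp : M → ℂ}
    (hgen : ∀ (x : M) (t : ℝˣ), f (generic x t) = gm x * tMinus (-a) t + gp x * tPlus (-a) t)
    {s : ℝ} (hs : 0 < s) (x : M) (t : ℝˣ) :
    f (zoom s hs (generic x t)) = (s : ℂ) ^ a * f (generic x t) := by
  rw [zoom, hgen, hgen]
  have e : (((Units.mk0 s hs.ne')⁻¹ * t : ℝˣ) : ℝ) = s⁻¹ * t := by simp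
  rw [e, tPlus_mul _ (inv_pos.2 hs), tMinus_mul _ (inv_pos.2 hs), ofReal_inv_cpow hs]
  ring

variable [IsManifold (𝓡 m) ∞ M]

/-- Since `t_+^{-z} + (-1)^z t_-^{-z} = t^{-z}`, off `t = 0` the function is `t^{-z} gp - (-1)^z
t_-^{-z} (gp - gm)`. `G` is the smooth extension of the first term; the second is smooth by flatness
and vanishes at `t = 0`. -/
theorem isSmooth_of_intCast {gm gp : M → ℂ} (hm : ContMDiff (𝓡 m) 𝓘(ℝ, ℂ) ∞ gm)
    (hp : ContMDiff (𝓡 m) 𝓘(ℝ, ℂ) ∞ gp) (hflat : IsFlatOn m (gp - gm) (Set.range ι)) (z : ℤ)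
    (hgen : ∀ (x : M) (t : ℝˣ), f (generic x t) =
      (-1 : ℂ) ^ z * gm x * tMinus (-(z : ℂ)) t + gp x * tPlus (-(z : ℂ)) t)
    (hG : ∀ c : AdaptedChart m' m ι,
      ∃ G : EuclideanSpace ℝ (Fin m') × EuclideanSpace ℝ (Fin (m - m')) × ℝ → ℂ,
        ContDiffOn ℝ ∞ G c.domain ∧
        (∀ p ∈ c.domain, p.2.2 ≠ 0 →
          G p = (p.2.2 : ℂ) ^ (-z) * c.localRep gp (p.1, p.2.2 • p.2.1)) ∧
        ∀ y ξ, (y, 0) ∈ c.splitTarget → f (c.param (y, ξ, 0)) = G (y, ξ, 0)) :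
    IsSmooth f := by
  constructor
  · simp only [hgen]
    exact contMDiff_mul_tMinus_add_mul_tPlus (gm := fun x => (-1 : ℂ) ^ z * gm x)
      (contMDiff_const.complex_mul hm) hp _
  · intro c
    obtain ⟨G, hGs, hGg, hG0⟩ := hG c
    have hq := contDiffOn_tMinus_mul_deformation c.isOpen_splitTarget
      (c.contDiffOn_localRep (hp.sub hm))
      (fun y hy j => c.iteratedFDeriv_localRep_eq_zero (hp.sub hm) (hflat j) hy le_rfl)
      (-(z : ℂ))
    refine ContDiffOn.congr (hGs.sub (contDiffOn_const (c := (-1 : ℂ) ^ z) |>.mul hq)) ?_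
    rintro ⟨y, ξ, t⟩ hpΩ
    by_cases ht : t = 0
    · subst ht
      have hy : (y, 0) ∈ c.splitTarget := by
        simpa [AdaptedChart.domain_eq, deformationDomain] using hpΩ
      simp [hG0 y ξ hy, tMinus_of_nonneg]
    · rw [c.param_of_ne_zero _ ht, hgen, hGg _ hpΩ ht]
      have := tPlus_add_tMinus_intCast (-z) ht
      push_cast at this
      simp only [Units.val_mk0, ← this, AdaptedChart.localRep]
      have e : (-1 : ℂ) ^ (-z) = (-1) ^ z := by simp [zpow_neg, ← inv_zpow]
      rw [e]
      ring

end Backward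

end DNC

end Manifold

/-! ### The three cases of the theorem. -/

theorem dirDeriv_smul {m : ℕ} {M : Type*} [TopologicalSpace M]
    [ChartedSpace (EuclideanSpace ℝ (Fin m)) M] (k : ℕ) (g : M → ℂ) (p : M) (s : ℝ)
    (v : EuclideanSpace ℝ (Fin m)) :
    dirDeriv m k g p (s • v) = (s : ℂ) ^ k * dirDeriv m k g p v := by
  have := (iteratedFDeriv ℝ k (g ∘ (extChartAt (𝓡 m) p).symm)
    (extChartAt (𝓡 m) p p)).map_smul_univ (fun _ => s) (fun _ => v)
  simpa [dirDeriv] using this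

namespace DNC

variable {m' m : ℕ} {V M : Type*}
  [TopologicalSpace V] [ChartedSpace (EuclideanSpace ℝ (Fin m')) V] [IsManifold (𝓡 m') ∞ V]
  [TopologicalSpace M] [ChartedSpace (EuclideanSpace ℝ (Fin m)) M] [IsManifold (𝓡 m) ∞ M]
  {ι : V → M} {f : DNC m' m ι → ℂ} {a : ℂ}

omit [IsManifold (𝓡 m') ∞ V] [IsManifold (𝓡 m) ∞ M] in
theorem IsHomogeneous.generic_eq_intCast {z : ℤ} (h : IsHomogeneous (z : ℂ) f) (x : M) (t : ℝˣ) :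
    f (generic x t) = (-1 : ℂ) ^ z * ((-1 : ℂ) ^ z * f (generic x (-1)) * tMinus (-(z : ℂ)) t) +
      f (generic x 1) * tPlus (-(z : ℂ)) t := by
  have hz : (-1 : ℂ) ^ z * (-1) ^ z = 1 := by
    rw [← zpow_add₀ (by simp)]
    exact Even.neg_one_zpow ⟨z, rfl⟩
  rw [h.generic_eq x t]
  linear_combination (-(f (generic x (-1)) * tMinus (-(z : ℂ)) t)) * hz

omit [IsManifold (𝓡 m') ∞ V] in
theorem contDiffOn_pow_mul_localRep (c : AdaptedChart m' m ι) {g : M → ℂ}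
    (hg : ContMDiff (𝓡 m) 𝓘(ℝ, ℂ) ∞ g) (k : ℕ) :
    ContDiffOn ℝ ∞ (fun p : EuclideanSpace ℝ (Fin m') × EuclideanSpace ℝ (Fin (m - m')) × ℝ =>
      (p.2.2 : ℂ) ^ k * c.localRep g (p.1, p.2.2 • p.2.1)) c.domain := by
  have h1 : ContDiff ℝ ∞ fun p : EuclideanSpace ℝ (Fin m') × EuclideanSpace ℝ (Fin (m - m')) × ℝ =>
      (p.2.2 : ℂ) := Complex.ofRealCLM.contDiff.comp (by fun_prop)
  have h2 : ContDiff ℝ ∞ fun p : EuclideanSpace ℝ (Fin m') × EuclideanSpace ℝ (Fin (m - m')) × ℝ =>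
      (p.1, p.2.2 • p.2.1) := by fun_prop
  exact (h1.pow k).contDiffOn.mul ((c.contDiffOn_localRep hg).comp h2.contDiffOn fun _ h => h)

theorem characterization_of_nonpos (hι : Manifold.IsSmoothEmbedding (𝓡 m') (𝓡 m) ∞ ι) (k : ℕ)
    (ha : a = -(k : ℂ)) :
    (IsSmooth f ∧ IsHomogeneous a f) ↔
      ∃ fm fp : M → ℂ,
        ContMDiff (𝓡 m) 𝓘(ℝ, ℂ) ∞ fm ∧ ContMDiff (𝓡 m) 𝓘(ℝ, ℂ) ∞ fp ∧
        IsFlatOn m (fp - fm) (Set.range ι) ∧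
        (∀ (x : M) (t : ℝˣ), f (generic x t) =
          (-1 : ℂ) ^ a * (fm x * tMinus (-a) t) + fp x * tPlus (-a) t) ∧
        ∀ (x : V) (X : NormalFiber m' m ι x), f (normal x X) =
          if k = 0 then fp (ι x) else 0 := by
  have hz : a = ((-(k : ℤ) : ℤ) : ℂ) := by rw [ha]; push_cast; rfl
  constructor
  · rintro ⟨hf, h⟩
    rw [hz] at h ⊢
    simp only [Complex.cpow_intCast]
    refine ⟨fun x => (-1 : ℂ) ^ (-(k : ℤ)) * f (generic x (-1)), fun x => f (generic x 1),
      contMDiff_const.complex_mul (hf.contMDiff_slice _), hf.contMDiff_slice _,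
      isFlatOn_slice_sub hι hf h, h.generic_eq_intCast, fun x X => ?_⟩
    obtain ⟨v, rfl⟩ := Submodule.Quotient.mk_surjective _ X
    obtain ⟨c, hc, hcv⟩ := exists_chart_normal hι x v
    -- For `t > 0`, `f` is `t^k` times the slice at `t = 1`, read at `(y, tξ)`; at `t = 0` the
    -- factor `0^k` separates `k = 0` from `k > 0`.
    have key := eq_at_zero_of_eq_of_pos c (hf.2 c)
      (contDiffOn_pow_mul_localRep c (hf.contMDiff_slice 1) k) (fun p _ hp => ?_)
      (c.mem_splitTarget hc) (c.L (c.chartDeriv (ι x) v)).2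
    · rw [hcv] at key
      refine key.trans ?_
      have e : c.φ.symm (c.L.symm (c.χ x, 0)) = ι x := by
        rw [c.phi_symm_slice (c.mem_splitTarget hc), c.χ.left_inv hc]
      by_cases hk : k = 0 <;> simp [hk, AdaptedChart.localRep, e]
    · rw [localRep_pos h c p hp, tPlus_of_pos _ hp]
      push_cast
      rw [neg_neg, Complex.cpow_natCast]
  · rintro ⟨fm, fp, hm, hp, hflat, hgen, hnorm⟩
    refine ⟨?_, fun s hs p => ?_⟩
    · rw [hz] at hgen
      simp only [Complex.cpow_intCast] at hgen
      refine isSmooth_of_intCast hm hp hflat (-(k : ℤ)) (fun x t => by rw [hgen, mul_assoc])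
        fun c => ⟨_, contDiffOn_pow_mul_localRep c hp k, fun p _ _ => by simp, fun y ξ hy => ?_⟩
      rw [c.param_zero, hnorm]
      by_cases hk : k = 0 <;> simp [hk, AdaptedChart.localRep, c.phi_symm_slice hy]
    · cases p with
      | generic x t =>
        exact generic_zoom_eq (gm := fun x => (-1 : ℂ) ^ a * fm x)
          (fun x t => by rw [hgen, mul_assoc]) hs x t
      | normal x X =>
        rw [zoom, hnorm, hnorm]
        by_cases hk : k = 0 <;> simp [hk, ha]

theorem characterization_of_pos (hι : Manifold.IsSmoothEmbedding (𝓡 m') (𝓡 m) ∞ ι) (k : ℕ)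
    (hk : 1 ≤ k) (ha : a = (k : ℂ)) :
    (IsSmooth f ∧ IsHomogeneous a f) ↔
      ∃ fm fp : M → ℂ,
        ContMDiff (𝓡 m) 𝓘(ℝ, ℂ) ∞ fm ∧ ContMDiff (𝓡 m) 𝓘(ℝ, ℂ) ∞ fp ∧
        VanishesToOrderOn m (k - 1) fm (Set.range ι) ∧
        VanishesToOrderOn m (k - 1) fp (Set.range ι) ∧
        IsFlatOn m (fp - fm) (Set.range ι) ∧
        (∀ (x : M) (t : ℝˣ), f (generic x t) =
          (-1 : ℂ) ^ a * (fm x * tMinus (-a) t) + fp x * tPlus (-a) t) ∧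
        ∀ (x : V) (v : TangentSpace (𝓡 m) (ι x)),
          f (normal x (Submodule.Quotient.mk v)) =
            1 / (k.factorial : ℂ) * dirDeriv m k fp (ι x) v := by
  have hz : a = (((k : ℤ) : ℤ) : ℂ) := by rw [ha]; push_cast; rfl
  constructor
  · rintro ⟨hf, h⟩
    have hlow : ∀ r ≤ k - 1, ∀ n : ℕ, (r : ℂ) - a ≠ n := by
      intro r hr n e
      rw [ha, sub_eq_iff_eq_add] at e
      have : r = n + k := by exact_mod_cast e
      omega
    have hvp := vanishesToOrderOn_slice hι hf h hlow (d := 1) (by norm_num) 1 (by simp)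
    have hvm := vanishesToOrderOn_slice hι hf h hlow (d := -1) (by norm_num) (-1) (by simp)
    rw [hz] at h ⊢
    simp only [Complex.cpow_intCast]
    refine ⟨fun x => (-1 : ℂ) ^ (k : ℤ) * f (generic x (-1)), fun x => f (generic x 1),
      contMDiff_const.complex_mul (hf.contMDiff_slice _), hf.contMDiff_slice _,
      hvm.const_mul (hf.contMDiff_slice _) _, hvp,
      isFlatOn_slice_sub hι hf h, h.generic_eq_intCast, fun x v => ?_⟩
    obtain ⟨c, hc, hcv⟩ := exists_chart_normal hι x v
    have hmem : (c.χ x, (c.L (c.chartDeriv (ι x) v)).2, (0 : ℝ)) ∈ c.domain := by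
      simpa [AdaptedChart.domain_eq, deformationDomain] using c.mem_splitTarget hc
    have key := c.apply_normal_eq_dirDeriv hc (hf.contMDiff_slice 1) k
      (fun j hj => hvp.mono (by omega)) (G := fun p => f (c.param p))
      (((hf.2 c).contDiffAt ((isOpen_deformationDomain c.isOpen_splitTarget).mem_nhds
        hmem)).continuousAt) (fun p _ hp => ?_) v rfl
    · rw [hcv] at key
      exact key
    · have hp0 : (p.2.2 : ℂ) ^ k ≠ 0 := pow_ne_zero _ (by exact_mod_cast hp.ne')
      rw [localRep_pos h c p hp, tPlus_of_pos _ hp]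
      push_cast
      rw [Complex.cpow_neg, Complex.cpow_natCast, mul_inv_cancel_left₀ hp0]
  · rintro ⟨fm, fp, hm, hp, -, hvp, hflat, hgen, hnorm⟩
    refine ⟨?_, fun s hs p => ?_⟩
    · rw [hz] at hgen
      simp only [Complex.cpow_intCast] at hgen
      refine isSmooth_of_intCast hm hp hflat (k : ℤ) (fun x t => by rw [hgen, mul_assoc])
        fun c => ?_
      obtain ⟨G, hG, hGg⟩ := exists_contDiffOn_deformation c.isOpen_splitTarget
        (c.contDiffOn_localRep hp) k fun y hy j hj =>
          c.iteratedFDeriv_localRep_eq_zero hp hvp hy (show j ≤ k - 1 by omega)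
      refine ⟨G, hG, fun p hpΩ hp0 => ?_, fun y ξ hy => ?_⟩
      · have hp0' : (p.2.2 : ℂ) ^ k ≠ 0 := pow_ne_zero _ (by exact_mod_cast hp0)
        rw [hGg p hpΩ, zpow_neg, zpow_natCast, inv_mul_cancel_left₀ hp0']
      · have hy' := c.mem_target y hy
        have hx := c.χ.map_target hy'
        have hmem : (y, ξ, (0 : ℝ)) ∈ c.domain := by
          simpa [AdaptedChart.domain_eq, deformationDomain] using hy
        obtain ⟨D, hD⟩ := c.isInvertible_chartDeriv (c.mem_phi_source hx)
        -- The vector chosen is the representative of the normal class used by `param`; its normal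
        -- coordinate is `ξ`.
        have key := c.apply_normal_eq_dirDeriv hx hp k (fun j hj => hvp.mono (by omega))
          (G := G) (ξ := ξ) (by
            rw [c.χ.right_inv hy']
            exact (hG.contDiffAt ((isOpen_deformationDomain c.isOpen_splitTarget).mem_nhds
              hmem)).continuousAt) (fun p hpΩ _ => hGg p hpΩ)
          ((c.chartDeriv (ι (c.χ.symm y))).inverse (c.L.symm (0, ξ)))
          (by rw [← hD, ContinuousLinearMap.inverse_equiv]; simp)
        rw [c.χ.right_inv hy'] at key
        rw [key, c.param_zero]
        exact hnorm _ _
    · cases p with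
      | generic x t =>
        exact generic_zoom_eq (gm := fun x => (-1 : ℂ) ^ a * fm x)
          (fun x t => by rw [hgen, mul_assoc]) hs x t
      | normal x X =>
        obtain ⟨v, rfl⟩ := Submodule.Quotient.mk_surjective _ X
        rw [zoom, ← Submodule.Quotient.mk_smul, hnorm, hnorm, ha, Complex.cpow_natCast]
        rw [show dirDeriv m k fp (ι x) (s • v) = _ from dirDeriv_smul k fp (ι x) s v]
        ring

theorem characterization_of_nonint (hι : Manifold.IsSmoothEmbedding (𝓡 m') (𝓡 m) ∞ ι)
    (ha : ∀ n : ℤ, a ≠ (n : ℂ)) :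
    (IsSmooth f ∧ IsHomogeneous a f) ↔
      ∃ fm fp : M → ℂ,
        ContMDiff (𝓡 m) 𝓘(ℝ, ℂ) ∞ fm ∧ ContMDiff (𝓡 m) 𝓘(ℝ, ℂ) ∞ fp ∧
        IsFlatOn m fm (Set.range ι) ∧ IsFlatOn m fp (Set.range ι) ∧
        (∀ (x : M) (t : ℝˣ), f (generic x t) =
          fm x * tMinus (-a) t + fp x * tPlus (-a) t) ∧
        ∀ (x : V) (X : NormalFiber m' m ι x), f (normal x X) = 0 := by
  constructor
  · rintro ⟨hf, h⟩
    have hlow : ∀ r n : ℕ, (r : ℂ) - a ≠ n := by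
      intro r n e
      refine ha ((r : ℤ) - n) ?_
      push_cast
      linear_combination -e
    have hvp : IsFlatOn m (fun x => f (generic x 1)) (Set.range ι) := fun k =>
      vanishesToOrderOn_slice hι hf h (fun r _ => hlow r) (d := 1) (by norm_num) 1 (by simp)
    refine ⟨fun x => f (generic x (-1)), fun x => f (generic x 1), hf.contMDiff_slice _,
      hf.contMDiff_slice _, fun k => vanishesToOrderOn_slice hι hf h (fun r _ => hlow r)
        (d := -1) (by norm_num) (-1) (by simp), hvp, h.generic_eq, fun x X => ?_⟩
    obtain ⟨v, rfl⟩ := Submodule.Quotient.mk_surjective _ X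
    obtain ⟨c, hc, hcv⟩ := exists_chart_normal hι x v
    have key := eq_at_zero_of_eq_of_pos c (hf.2 c)
      (contDiffOn_tPlus_mul_deformation c.isOpen_splitTarget
        (c.contDiffOn_localRep (hf.contMDiff_slice 1))
        (fun y hy j => c.iteratedFDeriv_localRep_eq_zero (hf.contMDiff_slice 1) (hvp j) hy le_rfl)
        (-a)) (fun p _ hp => localRep_pos h c p hp)
      (c.mem_splitTarget hc) (c.L (c.chartDeriv (ι x) v)).2
    rw [hcv] at key
    refine key.trans ?_
    simp [tPlus_of_nonpos]
  · rintro ⟨fm, fp, hm, hp, hfm, hfp, hgen, hnorm⟩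
    refine ⟨⟨?_, fun c => ?_⟩, fun s hs p => ?_⟩
    · simp only [hgen]
      exact contMDiff_mul_tMinus_add_mul_tPlus hm hp _
    · have h1 := contDiffOn_tMinus_mul_deformation c.isOpen_splitTarget (c.contDiffOn_localRep hm)
        (fun y hy j => c.iteratedFDeriv_localRep_eq_zero hm (hfm j) hy le_rfl) (-a)
      have h2 := contDiffOn_tPlus_mul_deformation c.isOpen_splitTarget (c.contDiffOn_localRep hp)
        (fun y hy j => c.iteratedFDeriv_localRep_eq_zero hp (hfp j) hy le_rfl) (-a)
      refine (h1.add h2).congr fun p _ => ?_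
      obtain ⟨y, ξ, t⟩ := p
      by_cases ht : t = 0
      · subst ht
        simp [c.param_zero, hnorm, tPlus_of_nonpos, tMinus_of_nonneg]
      · rw [c.param_of_ne_zero _ ht, hgen]
        simp only [Units.val_mk0, AdaptedChart.localRep]
        ring
    · cases p with
      | generic x t => exact generic_zoom_eq hgen hs x t
      | normal x X => rw [zoom, hnorm, hnorm, mul_zero]

end DNC

theorem mainTheorem7 {m' m : ℕ} {V M : Type*}
    [TopologicalSpace V] [ChartedSpace (EuclideanSpace ℝ (Fin m')) V]
    [IsManifold (𝓡 m') ∞ V]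
    [TopologicalSpace M] [ChartedSpace (EuclideanSpace ℝ (Fin m)) M]
    [IsManifold (𝓡 m) ∞ M]
    (ι : V → M) (hι : Manifold.IsSmoothEmbedding (𝓡 m') (𝓡 m) ∞ ι)
    (a : ℂ) (f : DNC m' m ι → ℂ) :
    (∀ k : ℕ, a = -(k : ℂ) →
      ((DNC.IsSmooth f ∧ DNC.IsHomogeneous a f) ↔
        ∃ fm fp : M → ℂ,
          ContMDiff (𝓡 m) 𝓘(ℝ, ℂ) ∞ fm ∧ ContMDiff (𝓡 m) 𝓘(ℝ, ℂ) ∞ fp ∧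
          IsFlatOn m (fp - fm) (Set.range ι) ∧
          (∀ (x : M) (t : ℝˣ), f (DNC.generic x t) =
            (-1 : ℂ) ^ a * (fm x * tMinus (-a) t) + fp x * tPlus (-a) t) ∧
          ∀ (x : V) (X : NormalFiber m' m ι x), f (DNC.normal x X) =
            if k = 0 then fp (ι x) else 0)) ∧
    (∀ k : ℕ, 1 ≤ k → a = (k : ℂ) →
      ((DNC.IsSmooth f ∧ DNC.IsHomogeneous a f) ↔
        ∃ fm fp : M → ℂ,
          ContMDiff (𝓡 m) 𝓘(ℝ, ℂ) ∞ fm ∧ ContMDiff (𝓡 m) 𝓘(ℝ, ℂ) ∞ fp ∧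
          VanishesToOrderOn m (k - 1) fm (Set.range ι) ∧
          VanishesToOrderOn m (k - 1) fp (Set.range ι) ∧
          IsFlatOn m (fp - fm) (Set.range ι) ∧
          (∀ (x : M) (t : ℝˣ), f (DNC.generic x t) =
            (-1 : ℂ) ^ a * (fm x * tMinus (-a) t) + fp x * tPlus (-a) t) ∧
          ∀ (x : V) (v : TangentSpace (𝓡 m) (ι x)),
            f (DNC.normal x (Submodule.Quotient.mk v)) =
              1 / (k.factorial : ℂ) * dirDeriv m k fp (ι x) v)) ∧
    ((∀ n : ℤ, a ≠ (n : ℂ)) →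
      ((DNC.IsSmooth f ∧ DNC.IsHomogeneous a f) ↔
        ∃ fm fp : M → ℂ,
          ContMDiff (𝓡 m) 𝓘(ℝ, ℂ) ∞ fm ∧ ContMDiff (𝓡 m) 𝓘(ℝ, ℂ) ∞ fp ∧
          IsFlatOn m fm (Set.range ι) ∧ IsFlatOn m fp (Set.range ι) ∧
          (∀ (x : M) (t : ℝˣ), f (DNC.generic x t) =
            fm x * tMinus (-a) t + fp x * tPlus (-a) t) ∧
          ∀ (x : V) (X : NormalFiber m' m ι x), f (DNC.normal x X) = 0)) :=
  ⟨fun k hk => DNC.characterization_of_nonpos hι k hk,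
    fun k hk1 hk => DNC.characterization_of_pos hι k hk1 hk,
    fun ha => DNC.characterization_of_nonint hι ha⟩
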